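/- Let $X$ be a smooth compact (Hausdorff) manifold without boundary, of dimension $3$, and let $N \in \mathbb{N}$. Let $\mathcal{E}$ be the real vector space of $N \times N$ complex Hermitian matrices, with norm $\|A\|^2 = \operatorname{Tr}(A^2)$, and for $A \in \mathcal{E}$ let $\lambda_1(A) \le \dots \le \lambda_N(A)$ be the eigenvalues of $A$ repeated according to multiplicity. The space $C^\infty(X,\mathcal{E})$ carries the $C^\infty$ topology, that is, the topology of uniform convergence of the derivatives of every order, in every chart of $X$, on compact subsets of the image of the chart. A map $H \in C^\infty(X,\mathcal{E})$ has a degeneracy at $x_0 \in X$ if $H(x_0)$ has a repeated eigenvalue. This degeneracy is conical if, for some $n$ with $1 \le n \le N-1$: (i) $\lambda_n(H(x_0)) = \lambda_{n+1}(H(x_0))$, and all other eigenvalues of $H(x_0)$ are simple; (ii) there exist an open neighborhood $\Omega$ of $x_0$ and functions $\ell \in C^\infty(\Omega,\mathbb{R})$, $q \in C^\infty(\Omega,[0,\infty))$ such that $q$ has a non-degenerate critical value zero at $x_0$ (that is, $q(x_0) = 0$, $dq(x_0) = 0$ and the Hessian of $q$ at $x_0$ is non-degenerate) and, for all $x \in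 \Omega$, $$\lambda_n(H(x)) = \ell(x) - \sqrt{q(x)}, \qquad \lambda_{n+1}(H(x)) = \ell(x) + \sqrt{q(x)}.$$ Then the set $$\mathbb{M} = \big\{ H \in C^\infty(X,\mathcal{E}) : \text{all degeneracies of } H \text{ are conical} \big\}$$ is dense and open in $C^\infty(X,\mathcal{E})$. -/

import Mathlib

open scoped Manifold ContDiff Topology UniformConvergence

noncomputable section

section HermitianMatrices

attribute [local instance] Matrix.frobeniusNormedAddCommGroup Matrix.frobeniusNormedSpace

/-- The real vector space of `N × N` complex Hermitian matrices. -/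
def HermMat (N : ℕ) : Type :=
  ↥(selfAdjoint.submodule ℝ (Matrix (Fin N) (Fin N) ℂ))

/-- The Hilbert–Schmidt (Frobenius) norm, `‖A‖² = Tr (A²)`. -/
instance HermMat.instNormedAddCommGroup (N : ℕ) : NormedAddCommGroup (HermMat N) :=
  inferInstanceAs
    (NormedAddCommGroup ↥(selfAdjoint.submodule ℝ (Matrix (Fin N) (Fin N) ℂ)))

instance HermMat.instNormedSpace (N : ℕ) : NormedSpace ℝ (HermMat N) :=
  inferInstanceAs
    (NormedSpace ℝ ↥(selfAdjoint.submodule ℝ (Matrix (Fin N) (Fin N) ℂ)))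

end HermitianMatrices

/-- The underlying matrix of an element of `HermMat N`. -/
def HermMat.toMatrix {N : ℕ} (A : HermMat N) : Matrix (Fin N) (Fin N) ℂ := A.1

theorem HermMat.isHermitian {N : ℕ} (A : HermMat N) : A.toMatrix.IsHermitian := A.2

/-- The eigenvalues of a Hermitian matrix repeated according to multiplicity, in nondecreasing
order, indexed by `0, …, N - 1`.  (`eigenvalues₀` lists them in nonincreasing order.) -/
def HermMat.eig {N : ℕ} (A : HermMat N) (j : Fin N) : ℝ :=
  A.isHermitian.eigenvalues₀ (Fin.cast (Fintype.card_fin N).symm j.rev)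

theorem HermMat.eig_monotone {N : ℕ} (A : HermMat N) : Monotone A.eig := by
  intro i j h
  apply A.isHermitian.eigenvalues₀_antitone
  simpa using h

section Families

variable (X : Type*) [TopologicalSpace X] [ChartedSpace (EuclideanSpace ℝ (Fin 3)) X] (N : ℕ)

/-- `C^∞(X, 𝓔)`: smooth families of Hermitian matrices parametrised by the 3-manifold `X`. -/
abbrev HermFamily := C^∞⟮𝓡 3, X; 𝓘(ℝ, HermMat N), HermMat N⟯

/-- The `C^∞` topology: uniform convergence of the derivatives of every order `k`, in every
chart `e` of the smooth structure, on every compact subset of the image of `e`. -/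
instance HermFamily.smoothTopology : TopologicalSpace (HermFamily X N) :=
  ⨅ (e : OpenPartialHomeomorph X (EuclideanSpace ℝ (Fin 3)))
    (_ : e ∈ IsManifold.maximalAtlas (𝓡 3) ∞ X) (k : ℕ),
    TopologicalSpace.induced
      (fun H : HermFamily X N =>
        UniformOnFun.ofFun {K : Set (EuclideanSpace ℝ (Fin 3)) | IsCompact K ∧ K ⊆ e.target}
          (iteratedFDeriv ℝ k (fun y => H (e.symm y))))
      inferInstance

variable {X} {N}

/-- The function `u`, smooth near `x₀`, has at `x₀` a non-degenerate critical point with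
critical value zero.  (At a critical point, non-degeneracy of the Hessian does not depend on the
chart in which it is computed.) -/
def HasNondegCriticalValueZero (u : X → ℝ) (x₀ : X) : Prop :=
  u x₀ = 0 ∧ mfderiv (𝓡 3) 𝓘(ℝ, ℝ) u x₀ = 0 ∧
    ∀ v : EuclideanSpace ℝ (Fin 3),
      (∀ w : EuclideanSpace ℝ (Fin 3),
        fderiv ℝ (fderiv ℝ (fun y => u ((chartAt (EuclideanSpace ℝ (Fin 3)) x₀).symm y)))
          (chartAt (EuclideanSpace ℝ (Fin 3)) x₀ x₀) v w = 0) → v = 0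

/-- `H` has a degeneracy at `x₀`: the matrix `H x₀` has a repeated eigenvalue. -/
def HermFamily.HasDegeneracyAt (H : HermFamily X N) (x₀ : X) : Prop :=
  ∃ i j : Fin N, i ≠ j ∧ (H x₀).eig i = (H x₀).eig j

/-- `H` has a conical degeneracy at `x₀`: precisely two consecutive eigenvalues (number `n` and
`n + 1`) coincide at `x₀`, all others being simple, and near `x₀` these two eigenvalues are
`ℓ - √q` and `ℓ + √q` with `ℓ`, `q ≥ 0` smooth and `q` having a non-degenerate critical value
zero at `x₀`. -/
def HermFamily.HasConicalDegeneracyAt (H : HermFamily X N) (x₀ : X) : Prop :=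
  ∃ n m : Fin N, (m : ℕ) = n + 1 ∧
    (H x₀).eig n = (H x₀).eig m ∧
    (∀ j : Fin N, j ≠ n → j ≠ m → ∀ k : Fin N, k ≠ j → (H x₀).eig k ≠ (H x₀).eig j) ∧
    ∃ (Ω : Set X) (ℓ q : X → ℝ), IsOpen Ω ∧ x₀ ∈ Ω ∧
      ContMDiffOn (𝓡 3) 𝓘(ℝ, ℝ) ∞ ℓ Ω ∧
      ContMDiffOn (𝓡 3) 𝓘(ℝ, ℝ) ∞ q Ω ∧
      (∀ x ∈ Ω, 0 ≤ q x) ∧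
      HasNondegCriticalValueZero q x₀ ∧
      ∀ x ∈ Ω, (H x).eig n = ℓ x - √(q x) ∧ (H x).eig m = ℓ x + √(q x)

variable (X) (N)

/-- The set `𝕄` of smooth families all of whose degeneracies are conical. -/
def conicalFamilies : Set (HermFamily X N) :=
  {H | ∀ x₀ : X, H.HasDegeneracyAt x₀ → H.HasConicalDegeneracyAt x₀}

end Families

end

/-! Call the 1-jet of a family good at a point if the value has at most one coincidence of
eigenvalues, a double one (`AtMostOneDouble`), and the derivative compressed to a double eigenspace
is scalar only in the direction zero (`IsTransverse`). Everything rests on the equivalence, for a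
smooth family, of "all degeneracies are conical" with "good at every point"
(`mem_conicalFamilies_iff`).

The equivalence comes from a local normal form. Near a matrix with an exactly double eigenvalue, the
implicit function theorem continues the eigenspace to an invariant plane depending analytically on
A, on which A acts by a 2 × 2 matrix M. Then tr M / 2 and (tr M / 2)² - det M are analytic, and they
are the mean and the squared half-gap of the two eigenvalues. The Hessian of the squared half-gap
along the family is a definite form in the traceless part of the compressed derivative, so it is
non-degenerate exactly under transversality (`IsEigenframe.exists_local_form`).

Density needs only perturbation by constant matrices B. Matrices with a multiple eigenvalue are the
images of finitely many explicit parametrisations, and B is bad only through the map (parameters, x)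
↦ matrix(parameters) - F(x). For a triple eigenvalue or two double ones the source of this map has
smaller dimension than the target, so its image is null. For one double eigenvalue the dimensions
agree, by Sard almost every B is a regular value, and regularity gives transversality
(`ae_forall_atMostOneDouble_and_isTransverse`).

Openness holds because the good 1-jets form an open set (`isOpen_atMostOneDouble_and_isTransverse`)
and goodness is independent of the chart, so that finitely many compact pieces of charts suffice. -/

noncomputable section

open Matrix Module MeasureTheory

/-! ### Hermitian matrices: dimension, diagonalisation, continuity of eigenvalues -/

section MatrixAnalysis

open scoped ComplexOrder

attribute [local instance] Matrix.frobeniusNormedAddCommGroup Matrix.frobeniusNormedSpace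
  Matrix.frobeniusNormedRing Matrix.frobeniusNormedAlgebra

namespace HermMat

variable {N : ℕ}

@[ext]
theorem ext {A B : HermMat N} (h : A.toMatrix = B.toMatrix) : A = B := Subtype.ext h

/-- The element of `HermMat N` given by a Hermitian matrix. -/
def ofMatrix (M : Matrix (Fin N) (Fin N) ℂ) (h : M.IsHermitian) : HermMat N := ⟨M, h⟩

@[simp]
theorem toMatrix_ofMatrix (M : Matrix (Fin N) (Fin N) ℂ) (h : M.IsHermitian) :
    (ofMatrix M h).toMatrix = M := rfl

@[simp] theorem toMatrix_add (A B : HermMat N) : (A + B).toMatrix = A.toMatrix + B.toMatrix := rfl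
@[simp] theorem toMatrix_sub (A B : HermMat N) : (A - B).toMatrix = A.toMatrix - B.toMatrix := rfl
@[simp] theorem toMatrix_zero : (0 : HermMat N).toMatrix = 0 := rfl
@[simp] theorem toMatrix_smul (c : ℝ) (A : HermMat N) : (c • A).toMatrix = c • A.toMatrix := rfl

theorem norm_toMatrix (A : HermMat N) : ‖A.toMatrix‖ = ‖A‖ := rfl

/-- The inclusion of the Hermitian matrices into all matrices. -/
def toMatrixL (N : ℕ) : HermMat N →L[ℝ] Matrix (Fin N) (Fin N) ℂ :=
  (selfAdjoint.submodule ℝ (Matrix (Fin N) (Fin N) ℂ)).subtypeL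

@[simp] theorem toMatrixL_apply (A : HermMat N) : toMatrixL N A = A.toMatrix := rfl

instance : FiniteDimensional ℝ (HermMat N) :=
  inferInstanceAs (FiniteDimensional ℝ ↥(selfAdjoint.submodule ℝ (Matrix (Fin N) (Fin N) ℂ)))

instance : MeasurableSpace (HermMat N) := borel _

instance : BorelSpace (HermMat N) := ⟨rfl⟩

/-- Every complex matrix is A + iB for a unique pair of Hermitian matrices, so twice the dimension
is 2N². -/
theorem finrank_eq (N : ℕ) : finrank ℝ (HermMat N) = N * N := by
  let f : (HermMat N × HermMat N) →ₗ[ℝ] Matrix (Fin N) (Fin N) ℂ :=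
    { toFun := fun p => p.1.toMatrix + Complex.I • p.2.toMatrix
      map_add' := fun p q => by simp [smul_add]; abel
      map_smul' := fun c p => by simp [smul_add, smul_comm c Complex.I] }
  have hf : Function.Bijective f := by
    constructor
    · rw [← LinearMap.ker_eq_bot, LinearMap.ker_eq_bot']
      rintro ⟨A, B⟩ h
      have h1 : A.toMatrix + Complex.I • B.toMatrix = 0 := h
      have h2 := congrArg Matrix.conjTranspose h1
      rw [conjTranspose_add, conjTranspose_smul, A.isHermitian.eq, B.isHermitian.eq] at h2
      simp only [RCLike.star_def, Complex.conj_I, conjTranspose_zero, neg_smul] at h2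
      have hA : A.toMatrix = 0 := by
        have : (2 : ℂ) • A.toMatrix = 0 := by
          have h3 := congrArg₂ (· + ·) h1 h2
          simp only [add_zero] at h3
          rw [two_smul, ← h3]
          abel
        simpa using this
      have hB : B.toMatrix = 0 := by
        rw [hA, zero_add] at h1
        simpa using h1
      exact Prod.ext (HermMat.ext hA) (HermMat.ext hB)
    · intro M
      refine ⟨(⟨(realPart M : Matrix (Fin N) (Fin N) ℂ), (realPart M).2⟩,
        ⟨(imaginaryPart M : Matrix (Fin N) (Fin N) ℂ), (imaginaryPart M).2⟩), ?_⟩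
      exact realPart_add_I_smul_imaginaryPart M
  have h := (LinearEquiv.ofBijective f hf).finrank_eq
  rw [finrank_prod, Module.finrank_matrix, Complex.finrank_real_complex] at h
  simp only [Fintype.card_fin] at h
  omega

/-- A unitary matrix diagonalising `A`, its columns being ordered like the eigenvalues `eig`. -/
theorem exists_unitary (A : HermMat N) : ∃ U : Matrix (Fin N) (Fin N) ℂ,
    Uᴴ * U = 1 ∧ U * Uᴴ = 1 ∧ A.toMatrix * U = U * diagonal (fun j => (A.eig j : ℂ)) := by
  -- `s` reverses the order and then applies the reindexing built into `eigenvalues`, so that column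
  -- `j` belongs to `A.eig j`.
  let s : Fin N ≃ Fin N :=
    (Fin.revPerm.trans (finCongr (Fintype.card_fin N).symm)).trans
      (Fintype.equivOfCardEq (Fintype.card_fin _))
  have hs : ∀ j, A.eig j = A.isHermitian.eigenvalues (s j) := by
    intro j
    simp only [HermMat.eig, Matrix.IsHermitian.eigenvalues, s]
    congr 1
    simp
  let U₀ : Matrix (Fin N) (Fin N) ℂ := A.isHermitian.eigenvectorUnitary
  have hU₀ : U₀ᴴ * U₀ = 1 := Unitary.coe_star_mul_self A.isHermitian.eigenvectorUnitary
  have h1 : (U₀.submatrix id s)ᴴ * U₀.submatrix id s = 1 := by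
    have := submatrix_mul_equiv U₀ᴴ U₀ s (Equiv.refl _) s
    rw [conjTranspose_submatrix]
    exact this.trans (by rw [hU₀]; simp)
  refine ⟨U₀.submatrix id s, h1, mul_eq_one_comm.mp h1, ?_⟩
  ext i j
  rw [mul_diagonal]
  have := congrFun (A.isHermitian.mulVec_eigenvectorBasis (s j)) i
  rw [hs j]
  simp only [mulVec, dotProduct, Pi.smul_apply, Complex.real_smul] at this
  simp only [mul_apply, submatrix_apply, id, U₀, Matrix.IsHermitian.eigenvectorUnitary_apply]
  rw [mul_comm _ (_ : ℂ)]
  exact this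

end HermMat

theorem frobenius_norm_col_sq {N : ℕ} (X : Matrix (Fin N) (Fin 1) ℂ) :
    ‖X‖ ^ 2 = ∑ i, ‖X i 0‖ ^ 2 := by
  rw [frobenius_norm_def, ← Real.sqrt_eq_rpow, Real.sq_sqrt (by positivity)]
  simp

theorem norm_entry_le_frobenius {m n : Type*} [Fintype m] [Fintype n] (M : Matrix m n ℂ)
    (i : m) (j : n) : ‖M i j‖ ≤ ‖M‖ := by
  rw [frobenius_norm_def, ← Real.sqrt_eq_rpow]
  apply Real.le_sqrt_of_sq_le
  simp only [Real.rpow_two]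
  calc ‖M i j‖ ^ 2 ≤ ∑ j, ‖M i j‖ ^ 2 :=
        Finset.single_le_sum (f := fun j => ‖M i j‖ ^ 2) (fun _ _ => by positivity)
          (Finset.mem_univ j)
    _ ≤ _ := Finset.single_le_sum (f := fun i => ∑ j, ‖M i j‖ ^ 2) (fun _ _ => by positivity)
          (Finset.mem_univ i)

namespace HermMat

variable {N : ℕ}

theorem re_quadratic_eq (A : HermMat N) {U : Matrix (Fin N) (Fin N) ℂ} (hU : U * Uᴴ = 1)
    (hA : A.toMatrix * U = U * diagonal (fun j => (A.eig j : ℂ)))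
    (X : Matrix (Fin N) (Fin 1) ℂ) :
    ((Xᴴ * A.toMatrix * X) 0 0).re = ∑ i, A.eig i * ‖(Uᴴ * X) i 0‖ ^ 2 := by
  have h : Xᴴ * A.toMatrix * X
      = (Uᴴ * X)ᴴ * (diagonal (fun j => (A.eig j : ℂ)) * (Uᴴ * X)) := by
    calc Xᴴ * A.toMatrix * X = Xᴴ * (A.toMatrix * (U * Uᴴ)) * X := by rw [hU, Matrix.mul_one]
      _ = Xᴴ * (A.toMatrix * U * Uᴴ) * X := by rw [Matrix.mul_assoc A.toMatrix]
      _ = _ := by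
        rw [hA]
        simp only [conjTranspose_mul, conjTranspose_conjTranspose, Matrix.mul_assoc]
  rw [h, mul_apply, Complex.re_sum]
  refine Finset.sum_congr rfl fun i _ => ?_
  rw [diagonal_mul, conjTranspose_apply, ← mul_assoc, mul_comm (star _), mul_assoc,
    RCLike.star_def, ← Complex.normSq_eq_conj_mul_self, ← Complex.ofReal_mul, Complex.ofReal_re,
    Complex.normSq_eq_norm_sq]

theorem frobenius_norm_unitary_mul {U : Matrix (Fin N) (Fin N) ℂ} (hU : U * Uᴴ = 1)
    (X : Matrix (Fin N) (Fin 1) ℂ) : ∑ i, ‖(Uᴴ * X) i 0‖ ^ 2 = ∑ i, ‖X i 0‖ ^ 2 := by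
  have key : ∀ Y : Matrix (Fin N) (Fin 1) ℂ, ((Yᴴ * Y) 0 0) = ((∑ i, ‖Y i 0‖ ^ 2 : ℝ) : ℂ) := by
    intro Y
    rw [mul_apply, Complex.ofReal_sum]
    refine Finset.sum_congr rfl fun i _ => ?_
    rw [conjTranspose_apply, RCLike.star_def, ← Complex.normSq_eq_conj_mul_self,
      Complex.normSq_eq_norm_sq]
  have h : (Uᴴ * X)ᴴ * (Uᴴ * X) = Xᴴ * X := by
    rw [conjTranspose_mul, conjTranspose_conjTranspose, Matrix.mul_assoc, ← Matrix.mul_assoc U,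
      hU, Matrix.one_mul]
  have := key X
  rw [← h, key] at this
  exact_mod_cast this

/-- One half of Weyl's inequality. -/
theorem eig_le_eig_add_norm (A B : HermMat N) (j : Fin N) : B.eig j ≤ A.eig j + ‖B - A‖ := by
  obtain ⟨U, -, hU, hA⟩ := A.exists_unitary
  obtain ⟨V, -, hV, hB⟩ := B.exists_unitary
  -- Courant–Fischer by counting: vanishing of the `B`-coordinates below `j` and of the
  -- `A`-coordinates above `j` is N - 1 conditions, so some nonzero x meets them all. Its Rayleigh
  -- quotient is at most `A.eig j` for `A` and at least `B.eig j` for `B`.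
  let f : (Fin N → ℂ) →ₗ[ℂ] ({i : Fin N // i ≠ j} → ℂ) :=
    LinearMap.pi fun i => if i.1 < j then (LinearMap.proj i.1) ∘ₗ (Vᴴ).mulVecLin
      else (LinearMap.proj i.1) ∘ₗ (Uᴴ).mulVecLin
  have hker : LinearMap.ker f ≠ ⊥ := by
    apply LinearMap.ker_ne_bot_of_finrank_lt
    have : Fintype.card {i : Fin N // i ≠ j} = N - 1 := by
      simp [Fintype.card_subtype_compl]
    rw [finrank_pi, finrank_pi, this, Fintype.card_fin]
    have := j.2
    omega
  obtain ⟨x, hx, hx0⟩ := (Submodule.ne_bot_iff _).mp hker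
  let X : Matrix (Fin N) (Fin 1) ℂ := Matrix.of fun i _ => x i
  have hXA : ∀ i, j < i → (Uᴴ * X) i 0 = 0 := by
    intro i hi
    have := congrFun (LinearMap.mem_ker.mp hx) ⟨i, hi.ne'⟩
    simpa [f, not_lt.mpr hi.le, mulVec, dotProduct, mul_apply, X] using this
  have hXB : ∀ i, i < j → (Vᴴ * X) i 0 = 0 := by
    intro i hi
    have := congrFun (LinearMap.mem_ker.mp hx) ⟨i, hi.ne⟩
    simpa [f, hi, mulVec, dotProduct, mul_apply, X] using this
  have hpos : 0 < ∑ i, ‖X i 0‖ ^ 2 := by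
    obtain ⟨i, hi⟩ := Function.ne_iff.mp hx0
    refine Finset.sum_pos' (fun _ _ => by positivity) ⟨i, Finset.mem_univ _, ?_⟩
    have : X i 0 ≠ 0 := hi
    positivity
  have h1 : ((Xᴴ * A.toMatrix * X) 0 0).re ≤ A.eig j * ∑ i, ‖X i 0‖ ^ 2 := by
    rw [re_quadratic_eq A hU hA, ← frobenius_norm_unitary_mul hU, Finset.mul_sum]
    refine Finset.sum_le_sum fun i _ => ?_
    rcases lt_or_ge j i with h | h
    · simp [hXA i h]
    · exact mul_le_mul_of_nonneg_right (A.eig_monotone h) (by positivity)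
  have h2 : B.eig j * ∑ i, ‖X i 0‖ ^ 2 ≤ ((Xᴴ * B.toMatrix * X) 0 0).re := by
    rw [re_quadratic_eq B hV hB, ← frobenius_norm_unitary_mul hV, Finset.mul_sum]
    refine Finset.sum_le_sum fun i _ => ?_
    rcases lt_or_ge i j with h | h
    · simp [hXB i h]
    · exact mul_le_mul_of_nonneg_right (B.eig_monotone h) (by positivity)
  have h3 : ((Xᴴ * B.toMatrix * X) 0 0).re - ((Xᴴ * A.toMatrix * X) 0 0).re
      ≤ ‖B - A‖ * ∑ i, ‖X i 0‖ ^ 2 := by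
    rw [← Complex.sub_re, ← Matrix.sub_apply, ← Matrix.sub_mul, ← Matrix.mul_sub, ← toMatrix_sub]
    calc _ ≤ ‖(Xᴴ * (B - A).toMatrix * X) 0 0‖ := Complex.re_le_norm _
      _ ≤ ‖Xᴴ * (B - A).toMatrix * X‖ := norm_entry_le_frobenius _ _ _
      _ ≤ ‖Xᴴ‖ * ‖(B - A).toMatrix‖ * ‖X‖ :=
        (frobenius_norm_mul _ _).trans
          (mul_le_mul_of_nonneg_right (frobenius_norm_mul _ _) (norm_nonneg _))
      _ = ‖B - A‖ * ‖X‖ ^ 2 := by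
        rw [frobenius_norm_conjTranspose, norm_toMatrix]
        ring
      _ = _ := by rw [frobenius_norm_col_sq]
  nlinarith

theorem continuous_eig (j : Fin N) : Continuous fun A : HermMat N => A.eig j := by
  have : LipschitzWith 1 fun A : HermMat N => A.eig j := by
    refine LipschitzWith.of_le_add fun A B => ?_
    rw [dist_eq_norm]
    exact eig_le_eig_add_norm B A j
  exact this.continuous

end HermMat

/-! ### Normal form of a Hermitian matrix with prescribed kernel vectors -/

/-- A matrix with linearly independent columns has an invertible square block of rows. -/
theorem Matrix.exists_equiv_isUnit_toRows₁ {n k : ℕ} (W : Matrix (Fin n) (Fin k) ℂ)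
    {V : Matrix (Fin k) (Fin n) ℂ} (hV : V * W = 1) :
    ∃ σ : Fin n ≃ Fin k ⊕ Fin (n - k), IsUnit (W.submatrix σ.symm id).toRows₁ := by
  obtain ⟨κ, a, ha, hspan, hli⟩ := exists_linearIndependent' ℂ W.row
  have htop : Submodule.span ℂ (Set.range W.row) = ⊤ := by
    rw [← range_vecMulLinear, LinearMap.range_eq_top]
    intro x
    exact ⟨x ᵥ* V, by simp [vecMul_vecMul, hV]⟩
  let b : Basis κ ℂ (Fin k → ℂ) := Basis.mk hli (by rw [hspan, htop])
  let e : Fin k ≃ κ := (Pi.basisFun ℂ (Fin k)).indexEquiv b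
  have hinj : Function.Injective (a ∘ e) := ha.comp e.injective
  have hcard : Fintype.card ↑(Set.range (a ∘ e))ᶜ = n - k := by
    rw [Fintype.card_compl_set, Set.card_range_of_injective hinj]
    simp
  let τ : Fin k ⊕ Fin (n - k) ≃ Fin n :=
    (Equiv.sumCongr (Equiv.ofInjective _ hinj) (Fintype.equivFinOfCardEq hcard).symm).trans
      (Equiv.Set.sumCompl _)
  refine ⟨τ.symm, ?_⟩
  rw [← linearIndependent_rows_iff_isUnit]
  have h : (W.submatrix τ.symm.symm id).toRows₁.row = W.row ∘ a ∘ e := by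
    ext i j
    simp [τ, toRows₁, Matrix.row]
    rfl
  rw [h]
  exact hli.comp e e.injective

/-- The matrix with rows indexed by `Fin n ≃ Fin k ⊕ Fin r` whose two blocks are `T` and `1`. -/
def graphMatrix {n k r : ℕ} (σ : Fin n ≃ Fin k ⊕ Fin r) (T : Matrix (Fin k) (Fin r) ℂ) :
    Matrix (Fin n) (Fin r) ℂ :=
  (fromRows T 1).submatrix σ id

theorem conjTranspose_graphMatrix_mul_self {n k r : ℕ} (σ : Fin n ≃ Fin k ⊕ Fin r)
    (T : Matrix (Fin k) (Fin r) ℂ) :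
    (graphMatrix σ T)ᴴ * graphMatrix σ T = Tᴴ * T + 1 := by
  rw [graphMatrix, conjTranspose_submatrix, submatrix_mul_equiv,
    conjTranspose_fromRows_eq_fromCols_conjTranspose, fromCols_mul_fromRows]
  simp

theorem isUnit_conjTranspose_graphMatrix_mul_self {n k r : ℕ} (σ : Fin n ≃ Fin k ⊕ Fin r)
    (T : Matrix (Fin k) (Fin r) ℂ) :
    IsUnit ((graphMatrix σ T)ᴴ * graphMatrix σ T) := by
  rw [conjTranspose_graphMatrix_mul_self]
  exact (PosDef.posSemidef_add (posSemidef_conjTranspose_mul_self T) PosDef.one).isUnit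

/-- A Hermitian matrix vanishing on the columns of `W` comes from a smaller Hermitian matrix. -/
theorem HermMat.exists_eq_graphMatrix_mul {n k : ℕ} (C : HermMat n)
    (W : Matrix (Fin n) (Fin k) ℂ) {V : Matrix (Fin k) (Fin n) ℂ} (hV : V * W = 1)
    (hCW : C.toMatrix * W = 0) :
    ∃ (σ : Fin n ≃ Fin k ⊕ Fin (n - k)) (T : Matrix (Fin k) (Fin (n - k)) ℂ)
      (R : HermMat (n - k)),
      C.toMatrix = graphMatrix σ T * R.toMatrix * (graphMatrix σ T)ᴴ ∧
        (graphMatrix σ T)ᴴ * W = 0 := by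
  obtain ⟨σ, hσ⟩ := W.exists_equiv_isUnit_toRows₁ hV
  set W' := W.submatrix σ.symm id with hW'
  set C' := C.toMatrix.submatrix σ.symm σ.symm with hC'
  have hCH : C'ᴴ = C' := by
    rw [hC', conjTranspose_submatrix, C.isHermitian.eq]
  have hCW' : C' * W' = 0 := by
    rw [hC', hW', submatrix_mul_equiv, hCW, submatrix_zero]
    rfl
  obtain ⟨P, Q, Q', R, hblk⟩ : ∃ P Q Q' R, C' = fromBlocks P Q Q' R :=
    ⟨_, _, _, _, (fromBlocks_toBlocks C').symm⟩
  obtain ⟨W₁, W₂, hW⟩ : ∃ W₁ W₂, W' = fromRows W₁ W₂ := ⟨_, _, (fromRows_toRows W').symm⟩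
  rw [hblk, fromBlocks_conjTranspose, fromBlocks_inj] at hCH
  obtain ⟨-, hQ', hQ, hR⟩ := hCH
  rw [hW, toRows₁_fromRows] at hσ
  rw [hblk, hW, fromBlocks_mul_fromRows, ← fromRows_zero, fromRows_ext_iff] at hCW'
  obtain ⟨h1, h2⟩ := hCW'
  obtain ⟨V₁, hV₁, hV₁'⟩ : ∃ V₁, W₁ * V₁ = 1 ∧ V₁ * W₁ = 1 :=
    ⟨W₁⁻¹, mul_nonsing_inv _ ((isUnit_iff_isUnit_det _).mp hσ),
      nonsing_inv_mul _ ((isUnit_iff_isUnit_det _).mp hσ)⟩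
  -- Since `W₁` is invertible, the two block rows of C W = 0 express the left blocks through the
  -- right ones, and hermiticity leaves `R` as the only free block.
  have e2 : Q' = -(R * (W₂ * V₁)) := by
    have := congrArg (· * V₁) h2
    simp only [Matrix.add_mul, Matrix.mul_assoc, hV₁, Matrix.mul_one, Matrix.zero_mul] at this
    exact eq_neg_of_add_eq_zero_left this
  have e1 : P = -(Q * (W₂ * V₁)) := by
    have := congrArg (· * V₁) h1
    simp only [Matrix.add_mul, Matrix.mul_assoc, hV₁, Matrix.mul_one, Matrix.zero_mul] at this
    exact eq_neg_of_add_eq_zero_left this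
  have e3 : Q = -((W₂ * V₁)ᴴ * R) := by
    rw [← hQ', e2, conjTranspose_neg, conjTranspose_mul, hR]
  have hRH : R.IsHermitian := hR
  -- This slope is the one making the columns of the graph matrix orthogonal to those of `W`: Tᴴ W₁
  -- + W₂ = 0.
  refine ⟨σ, -(W₂ * V₁)ᴴ, HermMat.ofMatrix R hRH, ?_, ?_⟩
  · have hC : C.toMatrix = C'.submatrix σ σ := by simp [hC']
    have hm : fromBlocks P Q Q' R
        = fromRows (-(W₂ * V₁)ᴴ) 1 * (R * fromCols (-(W₂ * V₁)) 1) := by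
      rw [mul_fromCols, fromRows_mul_fromCols, e1, e2, e3]
      simp [Matrix.mul_assoc]
    rw [hC, hblk, hm, toMatrix_ofMatrix, graphMatrix, conjTranspose_submatrix,
      conjTranspose_fromRows_eq_fromCols_conjTranspose, Matrix.mul_assoc]
    simp only [conjTranspose_neg, conjTranspose_conjTranspose, conjTranspose_one]
    rfl
  · have hWσ : W = W'.submatrix σ id := by simp [hW']
    rw [hWσ, graphMatrix, conjTranspose_submatrix, submatrix_mul_equiv, hW,
      conjTranspose_fromRows_eq_fromCols_conjTranspose, fromCols_mul_fromRows]
    simp [Matrix.mul_assoc, hV₁']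

/-! ### Sard's theorem and calculus of matrix-valued maps -/

/-- Sard's theorem for maps between spaces of nonincreasing dimension: the image of the points
where the derivative is not surjective is negligible. -/
theorem addHaar_image_eq_zero_of_not_surjective_fderivWithin
    {E' E : Type*} [NormedAddCommGroup E'] [NormedSpace ℝ E'] [FiniteDimensional ℝ E']
    [NormedAddCommGroup E] [NormedSpace ℝ E] [FiniteDimensional ℝ E] [MeasurableSpace E]
    [BorelSpace E] (μ : Measure E) [μ.IsAddHaarMeasure] (h : finrank ℝ E' ≤ finrank ℝ E)
    {f : E' → E} {f' : E' → E' →L[ℝ] E} {s : Set E'}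
    (hf : ∀ x ∈ s, HasFDerivWithinAt f (f' x) s x)
    (hs : ∀ x ∈ s, ¬ Function.Surjective (f' x)) : μ (f '' s) = 0 := by
  -- Precomposing with a linear surjection `π` from `E` onto `E'` keeps the image and makes source
  -- and target equal. Non-surjectivity of the derivative then becomes vanishing of a determinant.
  obtain ⟨ι, hι⟩ := finrank_le_iff_exists_linearMap.mp h
  obtain ⟨π₀, hπ₀⟩ := ι.exists_leftInverse_of_injective (LinearMap.ker_eq_bot.mpr hι)
  let π : E →L[ℝ] E' := LinearMap.toContinuousLinearMap π₀
  have hπ : Function.Surjective π := fun y => ⟨ι y, LinearMap.congr_fun hπ₀ y⟩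
  have himg : f '' s = (f ∘ π) '' (π ⁻¹' s) := by
    rw [Set.image_comp, Set.image_preimage_eq s hπ]
  rw [himg]
  refine addHaar_image_eq_zero_of_det_fderivWithin_eq_zero μ (f' := fun x => (f' (π x)).comp π)
    (fun x hx => (hf _ hx).comp x π.hasFDerivWithinAt (Set.mapsTo_preimage _ _)) ?_
  intro x hx
  by_contra hdet
  apply hs _ hx
  have hu : IsUnit ((f' (π x)).comp π : E →ₗ[ℝ] E) := by
    rw [LinearMap.isUnit_iff_isUnit_det]
    exact isUnit_iff_ne_zero.mpr hdet
  intro y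
  obtain ⟨z, hz⟩ := ((Module.End.isUnit_iff _).mp hu).2 y
  exact ⟨π z, hz⟩

theorem isBoundedBilinearMap_matrix_mul (l m n : Type*) [Fintype l] [Fintype m] [Fintype n] :
    IsBoundedBilinearMap ℝ (fun p : Matrix l m ℂ × Matrix m n ℂ => p.1 * p.2) where
  add_left := Matrix.add_mul
  smul_left := fun c x y => Matrix.smul_mul c x y
  add_right := Matrix.mul_add
  smul_right := fun c x y => Matrix.mul_smul x c y
  bound := ⟨1, one_pos, fun x y => by simpa using frobenius_norm_mul x y⟩

section MatrixCalculus

variable {l m n : Type*} [Fintype l] [Fintype m] [Fintype n]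
  {E : Type*} [NormedAddCommGroup E] [NormedSpace ℝ E]
  {G : E → Matrix l m ℂ} {K : E → Matrix m n ℂ} {x : E} {k : WithTop ℕ∞}

theorem DifferentiableAt.matrix_mul (hG : DifferentiableAt ℝ G x) (hK : DifferentiableAt ℝ K x) :
    DifferentiableAt ℝ (fun y => G y * K y) x :=
  DifferentiableAt.comp (g := fun p : Matrix l m ℂ × Matrix m n ℂ => p.1 * p.2) x
    ((isBoundedBilinearMap_matrix_mul l m n).differentiableAt (G x, K x)) (hG.prodMk hK)

theorem ContDiff.matrix_mul (hG : ContDiff ℝ k G) (hK : ContDiff ℝ k K) :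
    ContDiff ℝ k (fun y => G y * K y) :=
  (isBoundedBilinearMap_matrix_mul l m n).contDiff.comp (hG.prodMk hK)

theorem HasFDerivAt.matrix_mul {G' : E →L[ℝ] Matrix l m ℂ} {K' : E →L[ℝ] Matrix m n ℂ}
    (hG : HasFDerivAt G G' x) (hK : HasFDerivAt K K' x) :
    HasFDerivAt (fun y => G y * K y)
      (((isBoundedBilinearMap_matrix_mul l m n).deriv (G x, K x)).comp (G'.prod K')) x :=
  HasFDerivAt.comp (g := fun p : Matrix l m ℂ × Matrix m n ℂ => p.1 * p.2) x
    ((isBoundedBilinearMap_matrix_mul l m n).hasFDerivAt (G x, K x)) (hG.prodMk hK)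

/-- The derivative of a product vanishes where both factors do. -/
theorem HasFDerivAt.matrix_mul_of_eq_zero (hG : DifferentiableAt ℝ G x)
    (hK : DifferentiableAt ℝ K x) (hGx : G x = 0) (hKx : K x = 0) :
    HasFDerivAt (fun y => G y * K y) (0 : E →L[ℝ] Matrix l n ℂ) x := by
  refine (hG.hasFDerivAt.matrix_mul hK.hasFDerivAt).congr_fderiv ?_
  ext1 v
  change G x * fderiv ℝ K x v + fderiv ℝ G x v * K x = 0
  rw [hGx, hKx, Matrix.zero_mul, Matrix.mul_zero, add_zero]

/-- The conjugate transpose as a continuous real linear map. -/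
def conjTransposeL (m n : Type*) [Fintype m] [Fintype n] : Matrix m n ℂ →L[ℝ] Matrix n m ℂ :=
  LinearMap.toContinuousLinearMap
    { toFun := fun M => Mᴴ
      map_add' := conjTranspose_add
      map_smul' := fun c M => by simp }

@[simp] theorem conjTransposeL_apply (M : Matrix m n ℂ) : conjTransposeL m n M = Mᴴ := rfl

theorem DifferentiableAt.matrix_conjTranspose (hG : DifferentiableAt ℝ G x) :
    DifferentiableAt ℝ (fun y => (G y)ᴴ) x :=
  (conjTransposeL l m).differentiableAt.comp x hG

theorem DifferentiableAt.matrix_inv [DecidableEq m] {G : E → Matrix m m ℂ}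
    (hG : DifferentiableAt ℝ G x) (h : IsUnit (G x)) :
    DifferentiableAt ℝ (fun y => (G y)⁻¹) x := by
  have : CompleteSpace (Matrix m m ℂ) := FiniteDimensional.complete ℝ _
  simp_rw [nonsing_inv_eq_ringInverse]
  exact (differentiableAt_inverse (𝕜 := ℝ) h).comp x hG

end MatrixCalculus

theorem differentiable_graphMatrix {n k r : ℕ} (σ : Fin n ≃ Fin k ⊕ Fin r) :
    Differentiable ℝ (graphMatrix σ) := by
  let f : Matrix (Fin k) (Fin r) ℂ →ₗ[ℝ] Matrix (Fin n) (Fin r) ℂ :=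
    { toFun := fun T => (fromRows T 0).submatrix σ id
      map_add' := fun S T => by
        ext i j
        rcases h : σ i with a | a <;> simp [h]
      map_smul' := fun c T => by
        ext i j
        rcases h : σ i with a | a <;> simp [h] }
  have h : graphMatrix σ = fun T => LinearMap.toContinuousLinearMap f T
      + (fromRows 0 1 : Matrix (Fin k ⊕ Fin r) (Fin r) ℂ).submatrix σ id := by
    ext T i j
    rcases h : σ i with a | a <;> simp [graphMatrix, f, h]
  rw [h]
  exact (ContinuousLinearMap.differentiable _).add_const _

/-! ### Eigenframes, and almost everywhere avoidance of bad degeneracies -/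

namespace HermMat

variable {N : ℕ}

/-- The projection of matrices onto Hermitian matrices. -/
def hermPart (N : ℕ) : Matrix (Fin N) (Fin N) ℂ →L[ℝ] HermMat N :=
  LinearMap.toContinuousLinearMap
    { toFun := fun M => ofMatrix ((1 / 2 : ℝ) • (M + Mᴴ)) (by
        simp [IsHermitian, conjTranspose_smul, add_comm])
      map_add' := fun A B => by
        ext1
        change (1 / 2 : ℝ) • ((A + B) + (A + B)ᴴ)
          = (1 / 2 : ℝ) • (A + Aᴴ) + (1 / 2 : ℝ) • (B + Bᴴ)
        rw [conjTranspose_add, ← smul_add]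
        congr 1
        abel
      map_smul' := fun c A => by
        ext1
        change (1 / 2 : ℝ) • (c • A + (c • A)ᴴ) = c • (1 / 2 : ℝ) • (A + Aᴴ)
        rw [conjTranspose_smul, star_trivial, ← smul_add, smul_comm] }

theorem toMatrix_hermPart {M : Matrix (Fin N) (Fin N) ℂ} (h : M.IsHermitian) :
    (hermPart N M).toMatrix = M := by
  change (1 / 2 : ℝ) • (M + Mᴴ) = M
  rw [h.eq, ← two_smul ℝ, smul_smul]
  norm_num

@[simp]
theorem hermPart_toMatrix (A : HermMat N) : hermPart N A.toMatrix = A :=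
  HermMat.ext (toMatrix_hermPart A.isHermitian)

/-- The columns of `W` are orthonormal eigenvectors of `A` with eigenvalue `μ`. -/
def IsEigenframe {k : ℕ} (A : HermMat N) (W : Matrix (Fin N) (Fin k) ℂ) (μ : ℝ) : Prop :=
  Wᴴ * W = 1 ∧ A.toMatrix * W = (μ : ℂ) • W

/-- The only coincidence among the eigenvalues of `A` is at most one double eigenvalue. -/
def AtMostOneDouble (A : HermMat N) : Prop :=
  ∀ i j k l : Fin N, i < j → k < l → A.eig i = A.eig j → A.eig k = A.eig l → i = k ∧ j = l

/-- The linear map `D` is transverse at `A` to the matrices with a double eigenvalue: its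
compression to a double eigenspace is scalar only on the kernel. -/
def IsTransverse {V : Type*} [NormedAddCommGroup V] [NormedSpace ℝ V] (A : HermMat N)
    (D : V →L[ℝ] HermMat N) : Prop :=
  ∀ (W : Matrix (Fin N) (Fin 2) ℂ) (μ : ℝ) (v : V), A.IsEigenframe W μ →
    (∃ c : ℝ, Wᴴ * (D v).toMatrix * W = (c : ℂ) • 1) → v = 0

theorem isEigenframe_submatrix {k : ℕ} (A : HermMat N) {U : Matrix (Fin N) (Fin N) ℂ}
    (hU : Uᴴ * U = 1) (hA : A.toMatrix * U = U * diagonal (fun j => (A.eig j : ℂ)))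
    {f : Fin k → Fin N} (hf : Function.Injective f) {μ : ℝ} (hμ : ∀ i, A.eig (f i) = μ) :
    A.IsEigenframe (U.submatrix id f) μ := by
  constructor
  · have : (U.submatrix id f)ᴴ * U.submatrix id f = (Uᴴ * U).submatrix f f := by
      ext i j
      simp [mul_apply]
    rw [this, hU, submatrix_one f hf]
  · have : A.toMatrix * U.submatrix id f = (A.toMatrix * U).submatrix id f := by
      ext i j
      simp [mul_apply]
    rw [this, hA]
    ext i j
    simp [mul_diagonal, hμ, mul_comm]

/-- Two different coinciding pairs of indices either carry the same eigenvalue, and then involve at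
least three indices, or carry two distinct eigenvalues. -/
theorem exists_eigenframes_of_not_atMostOneDouble {A : HermMat N} (h : ¬ A.AtMostOneDouble) :
    (∃ (W : Matrix (Fin N) (Fin 3) ℂ) (μ : ℝ), A.IsEigenframe W μ) ∨
    ∃ (W W' : Matrix (Fin N) (Fin 2) ℂ) (μ ν : ℝ), μ ≠ ν ∧ A.IsEigenframe W μ ∧
      A.IsEigenframe W' ν := by
  obtain ⟨U, hU, -, hA⟩ := A.exists_unitary
  simp only [AtMostOneDouble, not_forall] at h
  obtain ⟨i, j, k, l, hij, hkl, eij, ekl, hne⟩ := h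
  have inj2 : ∀ a b : Fin N, a < b → Function.Injective ![a, b] := by
    intro a b hab x y hxy
    fin_cases x <;> fin_cases y <;> simp_all [hab.ne, hab.ne']
  have inj3 : ∀ a b c : Fin N, a < b → c ≠ a → c ≠ b → Function.Injective ![a, b, c] := by
    intro a b c hab hca hcb x y hxy
    fin_cases x <;> fin_cases y <;> simp_all [hab.ne, hab.ne', hca.symm, hcb.symm]
  by_cases hik : A.eig i = A.eig k
  · left
    by_cases hk : k ≠ i ∧ k ≠ j
    · refine ⟨_, A.eig i, A.isEigenframe_submatrix hU hA (inj3 i j k hij hk.1 hk.2) ?_⟩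
      intro x
      fin_cases x <;> simp [← eij, ← hik]
    · have hl : l ≠ i ∧ l ≠ j := by
        constructor <;> rintro rfl <;> grind
      refine ⟨_, A.eig i, A.isEigenframe_submatrix hU hA (inj3 i j l hij hl.1 hl.2) ?_⟩
      intro x
      fin_cases x <;> simp [← eij, ← ekl, ← hik]
  · right
    refine ⟨_, _, A.eig i, A.eig k, hik, A.isEigenframe_submatrix hU hA (inj2 i j hij) ?_,
      A.isEigenframe_submatrix hU hA (inj2 k l hkl) ?_⟩
    · intro x
      fin_cases x <;> simp [← eij]
    · intro x
      fin_cases x <;> simp [← ekl]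

/-- The Hermitian matrices with eigenvalue `μ` of multiplicity at least `k`, parametrised by `μ`,
the slope `T` of the orthogonal complement of the eigenspace, and a Hermitian matrix `R`. -/
def multiplicityMap {n k r : ℕ} (σ : Fin n ≃ Fin k ⊕ Fin r) (μ : ℝ)
    (T : Matrix (Fin k) (Fin r) ℂ) (R : Matrix (Fin r) (Fin r) ℂ) : HermMat n :=
  hermPart n ((μ : ℂ) • 1 + graphMatrix σ T * R * (graphMatrix σ T)ᴴ)

theorem isHermitian_multiplicityMap_aux {n k r : ℕ} (σ : Fin n ≃ Fin k ⊕ Fin r) (μ : ℝ)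
    (T : Matrix (Fin k) (Fin r) ℂ) {R : Matrix (Fin r) (Fin r) ℂ} (hR : R.IsHermitian) :
    ((μ : ℂ) • (1 : Matrix (Fin n) (Fin n) ℂ)
      + graphMatrix σ T * R * (graphMatrix σ T)ᴴ).IsHermitian := by
  refine IsHermitian.add ?_ (isHermitian_mul_mul_conjTranspose _ hR)
  simp [IsHermitian, conjTranspose_smul]

theorem toMatrix_multiplicityMap {n k r : ℕ} (σ : Fin n ≃ Fin k ⊕ Fin r) (μ : ℝ)
    (T : Matrix (Fin k) (Fin r) ℂ) {R : Matrix (Fin r) (Fin r) ℂ} (hR : R.IsHermitian) :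
    (multiplicityMap σ μ T R).toMatrix
      = (μ : ℂ) • 1 + graphMatrix σ T * R * (graphMatrix σ T)ᴴ :=
  toMatrix_hermPart (isHermitian_multiplicityMap_aux σ μ T hR)

/-- The matrix A - μ annihilates the frame, so the normal form applies to it. Only finitely many `σ`
occur, so null sets can be handled one `σ` at a time. -/
theorem IsEigenframe.exists_eq_multiplicityMap {n k : ℕ} {A : HermMat n}
    {W : Matrix (Fin n) (Fin k) ℂ} {μ : ℝ} (h : A.IsEigenframe W μ) :
    ∃ (σ : Fin n ≃ Fin k ⊕ Fin (n - k)) (T : Matrix (Fin k) (Fin (n - k)) ℂ)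
      (R : HermMat (n - k)), A = multiplicityMap σ μ T R.toMatrix ∧
        (graphMatrix σ T)ᴴ * W = 0 := by
  have hH : (A.toMatrix - (μ : ℂ) • 1).IsHermitian := by
    refine A.isHermitian.sub ?_
    simp [IsHermitian, conjTranspose_smul]
  obtain ⟨σ, T, R, hC, hW⟩ := (ofMatrix _ hH).exists_eq_graphMatrix_mul W h.1
    (by rw [toMatrix_ofMatrix, Matrix.sub_mul, h.2]; simp)
  refine ⟨σ, T, R, HermMat.ext ?_, hW⟩
  rw [toMatrix_multiplicityMap σ μ T R.isHermitian, ← hC, toMatrix_ofMatrix]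
  abel

section Calculus

variable {E : Type*} [NormedAddCommGroup E] [NormedSpace ℝ E] {x : E}

theorem differentiableAt_multiplicityMap {n k r : ℕ} (σ : Fin n ≃ Fin k ⊕ Fin r) {μ : E → ℝ}
    {T : E → Matrix (Fin k) (Fin r) ℂ} {R : E → Matrix (Fin r) (Fin r) ℂ}
    (hμ : DifferentiableAt ℝ μ x) (hT : DifferentiableAt ℝ T x) (hR : DifferentiableAt ℝ R x) :
    DifferentiableAt ℝ (fun y => multiplicityMap σ (μ y) (T y) (R y)) x := by
  have hL : DifferentiableAt ℝ (fun y => graphMatrix σ (T y)) x :=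
    (differentiable_graphMatrix σ _).comp x hT
  have h1 : DifferentiableAt ℝ (fun y => ((μ y : ℂ)) • (1 : Matrix (Fin n) (Fin n) ℂ)) x := by
    simp_rw [Complex.coe_smul]
    exact hμ.smul_const _
  exact (hermPart n).differentiableAt.comp x
    (h1.add ((hL.matrix_mul hR).matrix_mul hL.matrix_conjTranspose))

end Calculus

section Generic

variable {n : ℕ} {V : Type*} [NormedAddCommGroup V] [NormedSpace ℝ V] [FiniteDimensional ℝ V]
  {U : Set V} {F : V → HermMat n}

/-- With n = 3 + r the source of `Φ σ` has dimension r² + 6r + 4 < (r + 3)², so every point is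
critical and the image is null. If n < 3 there is no `σ`, and the truncated n - 3 does no harm. -/
theorem ae_forall_not_isEigenframe_three (hV : finrank ℝ V = 3)
    (hF : ∀ x ∈ U, DifferentiableAt ℝ F x) (m : Measure (HermMat n)) [m.IsAddHaarMeasure] :
    ∀ᵐ B ∂m, ∀ x ∈ U, ∀ (W : Matrix (Fin n) (Fin 3) ℂ) (μ : ℝ), ¬ (F x + B).IsEigenframe W μ := by
  let Φ : (Fin n ≃ Fin 3 ⊕ Fin (n - 3)) →
      ℝ × Matrix (Fin 3) (Fin (n - 3)) ℂ × HermMat (n - 3) × V → HermMat n :=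
    fun σ q => multiplicityMap σ q.1 q.2.1 q.2.2.1.toMatrix - F q.2.2.2
  have hnull : m (⋃ σ, Φ σ '' {q | q.2.2.2 ∈ U}) = 0 := by
    refine measure_iUnion_null fun σ => ?_
    have hdim : finrank ℝ (ℝ × Matrix (Fin 3) (Fin (n - 3)) ℂ × HermMat (n - 3) × V)
        < finrank ℝ (HermMat n) := by
      have hc := Fintype.card_congr σ
      simp only [Fintype.card_fin, Fintype.card_sum] at hc
      simp only [finrank_prod, finrank_eq, finrank_self, finrank_matrix, Fintype.card_fin,
        Complex.finrank_real_complex, hV]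
      generalize n - 3 = r at hc
      subst hc
      ring_nf
      omega
    refine addHaar_image_eq_zero_of_not_surjective_fderivWithin m hdim.le
      (f' := fderiv ℝ (Φ σ)) (fun q hq => ?_) (fun q _ hs => ?_)
    · have : DifferentiableAt ℝ (Φ σ) q := by
        refine (differentiableAt_multiplicityMap σ differentiableAt_fst
          differentiableAt_snd.fst ?_).sub ((hF _ hq).comp q differentiableAt_snd.snd.snd)
        exact (toMatrixL _).differentiableAt.comp q differentiableAt_snd.snd.fst
      exact this.hasFDerivAt.hasFDerivWithinAt
    · exact absurd (LinearMap.finrank_le_finrank_of_surjective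
        (f := (fderiv ℝ (Φ σ) q).toLinearMap) hs) (not_le.mpr hdim)
  refine measure_mono_null (fun B hB => ?_) hnull
  simp only [Set.mem_compl_iff, Set.mem_ofPred_eq, not_forall, not_not] at hB
  obtain ⟨x, hx, W, μ, h⟩ := hB
  obtain ⟨σ, T, R, hA, -⟩ := h.exists_eq_multiplicityMap
  exact Set.mem_iUnion.mpr ⟨σ, (μ, T, R, x), hx, by simp [Φ, ← hA]⟩

/-- The normal form is used twice. Write A - μ = L R Lᴴ and δ = ν - μ. If the columns of W' are
ν-eigenvectors, then R - δ (LᴴL)⁻¹ is Hermitian and kills Lᴴ W', hence has a normal form with a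
block of size n - 4. With n = r + 4 the parameters number r² + 8r + 13 < (r + 4)². -/
theorem ae_forall_not_isEigenframe_two_two (hV : finrank ℝ V = 3)
    (hF : ∀ x ∈ U, DifferentiableAt ℝ F x) (m : Measure (HermMat n)) [m.IsAddHaarMeasure] :
    ∀ᵐ B ∂m, ∀ x ∈ U, ∀ (W W' : Matrix (Fin n) (Fin 2) ℂ) (μ ν : ℝ), μ ≠ ν →
      (F x + B).IsEigenframe W μ → ¬ (F x + B).IsEigenframe W' ν := by
  let gram : (Fin n ≃ Fin 2 ⊕ Fin (n - 2)) → Matrix (Fin 2) (Fin (n - 2)) ℂ →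
      Matrix (Fin (n - 2)) (Fin (n - 2)) ℂ :=
    fun σ T => (graphMatrix σ T)ᴴ * graphMatrix σ T
  let Φ : (Fin n ≃ Fin 2 ⊕ Fin (n - 2)) × (Fin (n - 2) ≃ Fin 2 ⊕ Fin (n - 2 - 2)) →
      ℝ × Matrix (Fin 2) (Fin (n - 2)) ℂ × ℝ × Matrix (Fin 2) (Fin (n - 2 - 2)) ℂ ×
        HermMat (n - 2 - 2) × V → HermMat n :=
    fun σ q => multiplicityMap σ.1 q.1 q.2.1 ((q.2.2.1 : ℝ) • (gram σ.1 q.2.1)⁻¹ +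
      (multiplicityMap σ.2 0 q.2.2.2.1 q.2.2.2.2.1.toMatrix).toMatrix) - F q.2.2.2.2.2
  have hnull : m (⋃ σ, Φ σ '' {q | q.2.2.2.2.2 ∈ U}) = 0 := by
    refine measure_iUnion_null fun σ => ?_
    have hdim : finrank ℝ (ℝ × Matrix (Fin 2) (Fin (n - 2)) ℂ × ℝ ×
        Matrix (Fin 2) (Fin (n - 2 - 2)) ℂ × HermMat (n - 2 - 2) × V)
        < finrank ℝ (HermMat n) := by
      have hc := Fintype.card_congr σ.1
      have hc' := Fintype.card_congr σ.2
      simp only [Fintype.card_fin, Fintype.card_sum] at hc hc'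
      simp only [finrank_prod, finrank_eq, finrank_self, finrank_matrix, Fintype.card_fin,
        Complex.finrank_real_complex, hV]
      generalize n - 2 = r at hc hc'
      generalize r - 2 = r' at hc'
      subst hc
      subst hc'
      ring_nf
      omega
    refine addHaar_image_eq_zero_of_not_surjective_fderivWithin m hdim.le
      (f' := fderiv ℝ (Φ σ)) (fun q hq => ?_) (fun q _ hs => ?_)
    · have hL : DifferentiableAt ℝ (fun q : ℝ × Matrix (Fin 2) (Fin (n - 2)) ℂ × ℝ ×
          Matrix (Fin 2) (Fin (n - 2 - 2)) ℂ × HermMat (n - 2 - 2) × V =>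
          graphMatrix σ.1 q.2.1) q :=
        (differentiable_graphMatrix σ.1 _).comp q differentiableAt_snd.fst
      have : DifferentiableAt ℝ (Φ σ) q := by
        refine (differentiableAt_multiplicityMap σ.1 differentiableAt_fst
          differentiableAt_snd.fst (DifferentiableAt.add ?_ ?_)).sub
            ((hF _ hq).comp q differentiableAt_snd.snd.snd.snd.snd)
        · have hδ : DifferentiableAt ℝ (fun q : ℝ × Matrix (Fin 2) (Fin (n - 2)) ℂ × ℝ ×
              Matrix (Fin 2) (Fin (n - 2 - 2)) ℂ × HermMat (n - 2 - 2) × V => q.2.2.1) q :=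
            differentiableAt_snd.snd.fst
          exact hδ.smul
            ((hL.matrix_conjTranspose.matrix_mul hL).matrix_inv
              (isUnit_conjTranspose_graphMatrix_mul_self _ _))
        · refine (toMatrixL _).differentiableAt.comp q (differentiableAt_multiplicityMap σ.2
            (differentiableAt_const _) differentiableAt_snd.snd.snd.fst ?_)
          exact (toMatrixL _).differentiableAt.comp q differentiableAt_snd.snd.snd.snd.fst
      exact this.hasFDerivAt.hasFDerivWithinAt
    · exact absurd (LinearMap.finrank_le_finrank_of_surjective
        (f := (fderiv ℝ (Φ σ) q).toLinearMap) hs) (not_le.mpr hdim)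
  refine measure_mono_null (fun B hB => ?_) hnull
  simp only [Set.mem_compl_iff, Set.mem_ofPred_eq, not_forall, not_not] at hB
  obtain ⟨x, hx, W, W', μ, ν, hne, h, h'⟩ := hB
  obtain ⟨σ, T, R, hA, hW⟩ := h.exists_eq_multiplicityMap
  have hAm : (F x + B).toMatrix = _ :=
    (congrArg toMatrix hA).trans (toMatrix_multiplicityMap σ μ T R.isHermitian)
  set L := graphMatrix σ T with hLdef
  set δ : ℝ := ν - μ with hδ
  have hδ0 : (δ : ℂ) ≠ 0 := by
    exact_mod_cast sub_ne_zero.mpr hne.symm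
  have hgram : IsUnit (Lᴴ * L) := isUnit_conjTranspose_graphMatrix_mul_self σ T
  have hgdet := (isUnit_iff_isUnit_det _).mp hgram
  have h1 : L * (R.toMatrix * (Lᴴ * W')) = (δ : ℂ) • W' := by
    have h2 := h'.2
    rw [hAm, Matrix.add_mul, Matrix.smul_mul, Matrix.one_mul] at h2
    rw [hδ, Complex.ofReal_sub, sub_smul, ← h2]
    simp only [Matrix.mul_assoc]
    abel
  have h3 : R.toMatrix * (Lᴴ * W') = (δ : ℂ) • ((Lᴴ * L)⁻¹ * (Lᴴ * W')) := by
    have h4 := congrArg (fun M => (Lᴴ * L)⁻¹ * (Lᴴ * M)) h1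
    simp only [← Matrix.mul_assoc Lᴴ L, nonsing_inv_mul_cancel_left _ _ hgdet,
      Matrix.mul_smul] at h4
    exact h4
  have hgH : ((Lᴴ * L)⁻¹).IsHermitian := (isHermitian_conjTranspose_mul_self L).inv
  have hC : (R.toMatrix - δ • (Lᴴ * L)⁻¹).IsHermitian := by
    refine R.isHermitian.sub ?_
    rw [IsHermitian, conjTranspose_smul, hgH.eq, star_trivial]
  -- The normal form needs a left inverse of Lᴴ W'. Here L R Lᴴ W' = δ W' and W'ᴴ W' = 1 supply one,
  -- which is where δ ≠ 0 enters.
  have hZ : ((δ : ℂ)⁻¹ • (W'ᴴ * L * R.toMatrix)) * (Lᴴ * W') = 1 := by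
    rw [Matrix.smul_mul, Matrix.mul_assoc, Matrix.mul_assoc, h1, Matrix.mul_smul, h'.1,
      smul_smul, inv_mul_cancel₀ hδ0, one_smul]
  obtain ⟨σ', T', R', hR', -⟩ := (ofMatrix _ hC).exists_eq_graphMatrix_mul (Lᴴ * W') hZ (by
    rw [toMatrix_ofMatrix, Matrix.sub_mul, h3, ← Complex.coe_smul, Matrix.smul_mul, sub_self])
  refine Set.mem_iUnion.mpr ⟨(σ, σ'), (μ, T, δ, T', R', x), hx, ?_⟩
  have hR : δ • (gram σ T)⁻¹ + (multiplicityMap σ' 0 T' R'.toMatrix).toMatrix = R.toMatrix := by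
    rw [toMatrix_multiplicityMap σ' 0 T' R'.isHermitian, ← hR', toMatrix_ofMatrix]
    simp [gram, hLdef]
  simp only [Φ, hR, ← hA]
  abel

end Generic

/-- The compression `A ↦ Wᴴ A W`. -/
def compress {n k : ℕ} (W : Matrix (Fin n) (Fin k) ℂ) : HermMat n →L[ℝ] HermMat k :=
  LinearMap.toContinuousLinearMap
    { toFun := fun A => ofMatrix (Wᴴ * A.toMatrix * W)
        (isHermitian_conjTranspose_mul_mul W A.isHermitian)
      map_add' := fun A B => by
        ext1
        change Wᴴ * (A.toMatrix + B.toMatrix) * W = Wᴴ * A.toMatrix * W + Wᴴ * B.toMatrix * W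
        rw [Matrix.mul_add, Matrix.add_mul]
      map_smul' := fun c A => by
        ext1
        change Wᴴ * (c • A.toMatrix) * W = c • (Wᴴ * A.toMatrix * W)
        rw [Matrix.mul_smul, Matrix.smul_mul] }

@[simp]
theorem toMatrix_compress {n k : ℕ} (W : Matrix (Fin n) (Fin k) ℂ) (A : HermMat n) :
    (compress W A).toMatrix = Wᴴ * A.toMatrix * W := rfl

/-- The scalar matrices. -/
def scalarL (n : ℕ) : ℝ →L[ℝ] HermMat n :=
  (ContinuousLinearMap.id ℝ ℝ).smulRight (ofMatrix 1 isHermitian_one)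

@[simp]
theorem toMatrix_scalarL (n : ℕ) (c : ℝ) : (scalarL n c).toMatrix = (c : ℂ) • 1 := by
  change c • (1 : Matrix (Fin n) (Fin n) ℂ) = (c : ℂ) • 1
  rw [Complex.coe_smul]

section Generic

variable {n : ℕ} {V : Type*} [NormedAddCommGroup V] [NormedSpace ℝ V] {U : Set V}
  {F : V → HermMat n}

/-- To first order, the compression to the kernel of the adjoint of the graph matrix only sees the
scalar part of `multiplicityMap`. -/
theorem hasFDerivAt_compress_multiplicityMap_sub {k r : ℕ} (σ : Fin n ≃ Fin k ⊕ Fin r)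
    {W : Matrix (Fin n) (Fin k) ℂ} (hWW : Wᴴ * W = 1)
    (q : ℝ × Matrix (Fin k) (Fin r) ℂ × HermMat r × V)
    (hW : (graphMatrix σ q.2.1)ᴴ * W = 0) (hF : DifferentiableAt ℝ F q.2.2.2) :
    HasFDerivAt (fun q : ℝ × Matrix (Fin k) (Fin r) ℂ × HermMat r × V =>
        compress W (multiplicityMap σ q.1 q.2.1 q.2.2.1.toMatrix - F q.2.2.2))
      ((scalarL k).comp (ContinuousLinearMap.fst ℝ _ _) -
        ((compress W).comp (fderiv ℝ F q.2.2.2)).comp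
          ((ContinuousLinearMap.snd ℝ _ _).comp ((ContinuousLinearMap.snd ℝ _ _).comp
            (ContinuousLinearMap.snd ℝ _ _)))) q := by
  have hL : DifferentiableAt ℝ (fun q : ℝ × Matrix (Fin k) (Fin r) ℂ × HermMat r × V =>
      graphMatrix σ q.2.1) q :=
    (differentiable_graphMatrix σ _).comp q differentiableAt_snd.fst
  have hR : DifferentiableAt ℝ (fun q : ℝ × Matrix (Fin k) (Fin r) ℂ × HermMat r × V =>
      q.2.2.1.toMatrix) q :=
    (toMatrixL _).differentiableAt.comp q differentiableAt_snd.snd.fst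
  have hW' : Wᴴ * graphMatrix σ q.2.1 = 0 := by
    rw [← conjTranspose_conjTranspose (Wᴴ * graphMatrix σ q.2.1), conjTranspose_mul,
      conjTranspose_conjTranspose, hW, conjTranspose_zero]
  -- Wᴴ L and Lᴴ W both vanish at the base point, so Wᴴ L R Lᴴ W vanishes to second order, whatever
  -- the variations of T and R.
  have h0 := HasFDerivAt.matrix_mul_of_eq_zero
    ((differentiableAt_const Wᴴ).matrix_mul hL)
    ((hR.matrix_mul hL.matrix_conjTranspose).matrix_mul (differentiableAt_const W)) hW'
    (by rw [Matrix.mul_assoc, hW, Matrix.mul_zero])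
  have h1 := ((scalarL k).hasFDerivAt (x := q.1)).comp q
    (hasFDerivAt_fst (𝕜 := ℝ) (p := q))
  have h2 := ((hermPart k).hasFDerivAt.comp q h0).congr_fderiv
    (g' := 0) (ContinuousLinearMap.ext fun _ => (hermPart k).map_zero)
  have h3 : HasFDerivAt (fun q : ℝ × Matrix (Fin k) (Fin r) ℂ × HermMat r × V => q.2.2.2)
      ((ContinuousLinearMap.snd ℝ _ _).comp ((ContinuousLinearMap.snd ℝ _ _).comp
        (ContinuousLinearMap.snd ℝ _ _))) q :=
    hasFDerivAt_snd.snd.snd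
  have h4 : HasFDerivAt (fun q : ℝ × Matrix (Fin k) (Fin r) ℂ × HermMat r × V =>
      compress W (F q.2.2.2)) (((compress W).comp (fderiv ℝ F q.2.2.2)).comp
          ((ContinuousLinearMap.snd ℝ _ _).comp ((ContinuousLinearMap.snd ℝ _ _).comp
            (ContinuousLinearMap.snd ℝ _ _)))) q :=
    HasFDerivAt.comp (g := fun x => compress W (F x)) (f := fun q => q.2.2.2) q
      ((compress W).hasFDerivAt.comp _ hF.hasFDerivAt)
      h3
  have h5 := (h1.add h2).sub h4
  rw [add_zero] at h5
  refine h5.congr_of_eventuallyEq (Filter.Eventually.of_forall fun p => ?_)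
  ext1
  have hH : (Wᴴ * graphMatrix σ p.2.1 *
      (p.2.2.1.toMatrix * (graphMatrix σ p.2.1)ᴴ * W)).IsHermitian := by
    have := isHermitian_mul_mul_conjTranspose (Wᴴ * graphMatrix σ p.2.1) p.2.2.1.isHermitian
    rw [conjTranspose_mul, conjTranspose_conjTranspose] at this
    simpa only [Matrix.mul_assoc] using this
  change Wᴴ * ((multiplicityMap σ p.1 p.2.1 p.2.2.1.toMatrix).toMatrix - (F p.2.2.2).toMatrix) * W
    = (scalarL k p.1).toMatrix + (hermPart k _).toMatrix - Wᴴ * (F p.2.2.2).toMatrix * W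
  rw [toMatrix_multiplicityMap σ _ _ p.2.2.1.isHermitian, toMatrix_hermPart hH, toMatrix_scalarL,
    Matrix.mul_sub, Matrix.sub_mul, Matrix.mul_add, Matrix.add_mul]
  congr 2
  · rw [Matrix.mul_smul, Matrix.mul_one, Matrix.smul_mul, hWW]
  · simp only [Matrix.mul_assoc]

/-- Here source and target of `Φ σ` have equal dimension and Sard makes almost every `B` a regular
value. At a regular point, compressing the derivative shows that (c, v) ↦ c - Wᴴ (DF v) W maps ℝ × V
onto the Hermitian 2 × 2 matrices. Both sides have dimension 4, so this map is injective, which is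
transversality. -/
theorem ae_forall_isTransverse [FiniteDimensional ℝ V] (hV : finrank ℝ V = 3)
    (hF : ∀ x ∈ U, DifferentiableAt ℝ F x) (m : Measure (HermMat n)) [m.IsAddHaarMeasure] :
    ∀ᵐ B ∂m, ∀ x ∈ U, (F x + B).IsTransverse (fderiv ℝ F x) := by
  let Φ : (Fin n ≃ Fin 2 ⊕ Fin (n - 2)) →
      ℝ × Matrix (Fin 2) (Fin (n - 2)) ℂ × HermMat (n - 2) × V → HermMat n :=
    fun σ q => multiplicityMap σ q.1 q.2.1 q.2.2.1.toMatrix - F q.2.2.2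
  have hΦ : ∀ σ q, q.2.2.2 ∈ U → DifferentiableAt ℝ (Φ σ) q := by
    intro σ q hq
    refine (differentiableAt_multiplicityMap σ differentiableAt_fst
      differentiableAt_snd.fst ?_).sub ((hF _ hq).comp q differentiableAt_snd.snd.snd)
    exact (toMatrixL _).differentiableAt.comp q differentiableAt_snd.snd.fst
  have hnull : m (⋃ σ, Φ σ '' {q | q.2.2.2 ∈ U ∧ ¬ Function.Surjective (fderiv ℝ (Φ σ) q)})
      = 0 := by
    refine measure_iUnion_null fun σ => ?_
    have hdim : finrank ℝ (ℝ × Matrix (Fin 2) (Fin (n - 2)) ℂ × HermMat (n - 2) × V)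
        ≤ finrank ℝ (HermMat n) := by
      have hc := Fintype.card_congr σ
      simp only [Fintype.card_fin, Fintype.card_sum] at hc
      simp only [finrank_prod, finrank_eq, finrank_self, finrank_matrix, Fintype.card_fin,
        Complex.finrank_real_complex, hV]
      generalize n - 2 = r at hc
      subst hc
      ring_nf
      omega
    exact addHaar_image_eq_zero_of_not_surjective_fderivWithin m hdim
      (f' := fderiv ℝ (Φ σ)) (fun q hq => (hΦ σ q hq.1).hasFDerivAt.hasFDerivWithinAt)
      (fun q hq => hq.2)
  refine measure_mono_null (fun B hB => ?_) hnull
  by_contra hB'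
  apply hB
  intro x hx W μ v hW hc
  obtain ⟨c, hc⟩ := hc
  obtain ⟨σ, T, R, hA, hLW⟩ := hW.exists_eq_multiplicityMap
  let q : ℝ × Matrix (Fin 2) (Fin (n - 2)) ℂ × HermMat (n - 2) × V := (μ, T, R, x)
  have hsurj : Function.Surjective (fderiv ℝ (Φ σ) q) := by
    by_contra hns
    exact hB' (Set.mem_iUnion.mpr ⟨σ, q, ⟨hx, hns⟩, by simp [Φ, q, ← hA]⟩)
  have hder := (hasFDerivAt_compress_multiplicityMap_sub σ hW.1 q hLW (hF x hx)).unique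
    ((compress W).hasFDerivAt.comp q (hΦ σ q hx).hasFDerivAt)
  let ψ : ℝ × V →ₗ[ℝ] HermMat 2 := ((scalarL 2).comp (ContinuousLinearMap.fst ℝ ℝ V) -
    ((compress W).comp (fderiv ℝ F x)).comp (ContinuousLinearMap.snd ℝ ℝ V)).toLinearMap
  -- Compression by `W` has the right inverse Z ↦ W Z Wᴴ, so surjectivity survives compression.
  have hψ : Function.Surjective ψ := by
    intro Z
    obtain ⟨dq, hdq⟩ := hsurj
      (ofMatrix (W * Z.toMatrix * Wᴴ) (isHermitian_mul_mul_conjTranspose W Z.isHermitian))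
    refine ⟨(dq.1, dq.2.2.2), ?_⟩
    have h1 : ψ (dq.1, dq.2.2.2) = compress W (fderiv ℝ (Φ σ) q dq) :=
      congrArg (fun f => f dq) hder
    rw [h1, hdq]
    ext1
    change Wᴴ * (W * Z.toMatrix * Wᴴ) * W = Z.toMatrix
    calc _ = (Wᴴ * W) * Z.toMatrix * (Wᴴ * W) := by simp only [Matrix.mul_assoc]
      _ = _ := by rw [hW.1, Matrix.one_mul, Matrix.mul_one]
  have hinj : Function.Injective ψ := by
    refine (LinearMap.injective_iff_surjective_of_finrank_eq_finrank ?_).mpr hψ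
    rw [finrank_prod, finrank_eq, finrank_self, hV]
  have h0 : ψ (c, v) = 0 := by
    have : scalarL 2 c - compress W (fderiv ℝ F x v) = 0 := by
      ext1
      rw [toMatrix_sub, toMatrix_scalarL, toMatrix_compress, hc, sub_self, toMatrix_zero]
    exact this
  exact congrArg Prod.snd (hinj (h0.trans ψ.map_zero.symm))

end Generic

/-! ### Openness of the good 1-jets -/

theorem continuous_toMatrix : Continuous (toMatrix : HermMat N → Matrix (Fin N) (Fin N) ℂ) :=
  (toMatrixL N).continuous

theorem isOpen_atMostOneDouble : IsOpen {A : HermMat N | A.AtMostOneDouble} := by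
  simp only [AtMostOneDouble, Set.ofPred_forall]
  refine isOpen_iInter_of_finite fun i => isOpen_iInter_of_finite fun j =>
    isOpen_iInter_of_finite fun k => isOpen_iInter_of_finite fun l =>
    isOpen_iInter_of_finite fun _ => isOpen_iInter_of_finite fun _ => ?_
  by_cases h : i = k ∧ j = l
  · simp [h]
  · have : {A : HermMat N | A.eig i = A.eig j → A.eig k = A.eig l → i = k ∧ j = l}
        = {A | A.eig i ≠ A.eig j} ∪ {A | A.eig k ≠ A.eig l} := by
      ext A
      simp only [Set.mem_ofPred_eq, Set.mem_union]
      tauto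
    rw [this]
    exact (isOpen_ne_fun (continuous_eig i) (continuous_eig j)).union
      (isOpen_ne_fun (continuous_eig k) (continuous_eig l))

theorem isCompact_isometries (n k : ℕ) :
    IsCompact {W : Matrix (Fin n) (Fin k) ℂ | Wᴴ * W = 1} := by
  have : ProperSpace (Matrix (Fin n) (Fin k) ℂ) := FiniteDimensional.proper_real _
  refine Metric.isCompact_of_isClosed_isBounded ?_ ?_
  · exact isClosed_eq (by fun_prop) continuous_const
  · refine (Metric.isBounded_iff_subset_closedBall 0).mpr ⟨√k, fun W hW => ?_⟩
    rw [mem_closedBall_zero_iff, frobenius_norm_def, ← Real.sqrt_eq_rpow]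
    refine Real.sqrt_le_sqrt ?_
    rw [Finset.sum_comm]
    have : ∀ j, ∑ i, ‖W i j‖ ^ (2 : ℝ) = 1 := by
      intro j
      have h : (Wᴴ * W) j j = 1 := by rw [hW]; simp
      rw [mul_apply] at h
      have h' : ((∑ i, ‖W i j‖ ^ (2 : ℝ) : ℝ) : ℂ) = 1 := by
        rw [← h, Complex.ofReal_sum]
        refine Finset.sum_congr rfl fun i _ => ?_
        rw [conjTranspose_apply, RCLike.star_def, ← Complex.normSq_eq_conj_mul_self,
          Complex.normSq_eq_norm_sq, Real.rpow_two]
      exact_mod_cast h'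
    rw [Finset.sum_congr rfl fun j _ => this j]
    simp

variable {V : Type*} [NormedAddCommGroup V] [NormedSpace ℝ V]

/-- Normalising v and reading μ and c off as matrix entries leaves a closed condition on (W, v)
ranging over a compact set. -/
theorem not_isTransverse_iff (A : HermMat N) (D : V →L[ℝ] HermMat N) :
    ¬ A.IsTransverse D ↔ ∃ (W : Matrix (Fin N) (Fin 2) ℂ) (v : V), Wᴴ * W = 1 ∧ ‖v‖ = 1 ∧
      A.toMatrix * W = (((Wᴴ * A.toMatrix * W) 0 0).re : ℂ) • W ∧
      Wᴴ * (D v).toMatrix * W = (((Wᴴ * (D v).toMatrix * W) 0 0).re : ℂ) • 1 := by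
  constructor
  · intro h
    simp only [IsTransverse, not_forall] at h
    obtain ⟨W, μ, v, hW, ⟨c, hc⟩, hv⟩ := h
    have hc' : Wᴴ * (D (‖v‖⁻¹ • v)).toMatrix * W = ((‖v‖⁻¹ * c : ℝ) : ℂ) • 1 := by
      rw [map_smul, toMatrix_smul, Matrix.mul_smul, Matrix.smul_mul, hc, Complex.ofReal_mul,
        mul_smul, Complex.coe_smul ‖v‖⁻¹]
    refine ⟨W, ‖v‖⁻¹ • v, hW.1, ?_, ?_, ?_⟩
    · rw [norm_smul, norm_inv, norm_norm, inv_mul_cancel₀ (norm_ne_zero_iff.mpr hv)]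
    · rw [Matrix.mul_assoc, hW.2, Matrix.mul_smul, hW.1]
      simp
    · rw [hc']
      simp
  · rintro ⟨W, v, hW, hv, hA, hD⟩ h
    have := h W _ v ⟨hW, hA⟩ ⟨_, hD⟩
    simp [this] at hv

/-- The complement is the projection of a closed set along a compact factor, hence closed. -/
theorem isOpen_isTransverse [FiniteDimensional ℝ V] :
    IsOpen {p : HermMat N × (V →L[ℝ] HermMat N) | p.1.IsTransverse p.2} := by
  have : ProperSpace V := FiniteDimensional.proper_real _
  let K : Set (Matrix (Fin N) (Fin 2) ℂ × V) :=
    {W : Matrix (Fin N) (Fin 2) ℂ | Wᴴ * W = 1} ×ˢ Metric.sphere (0 : V) 1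
  have hK : CompactSpace K :=
    isCompact_iff_compactSpace.mp ((isCompact_isometries N 2).prod (isCompact_sphere 0 1))
  let Z : Set ((HermMat N × (V →L[ℝ] HermMat N)) × K) :=
    {z | z.1.1.toMatrix * z.2.1.1
        = (((z.2.1.1ᴴ * z.1.1.toMatrix * z.2.1.1) 0 0).re : ℂ) • z.2.1.1 ∧
      z.2.1.1ᴴ * (z.1.2 z.2.1.2).toMatrix * z.2.1.1
        = (((z.2.1.1ᴴ * (z.1.2 z.2.1.2).toMatrix * z.2.1.1) 0 0).re : ℂ) • 1}
  have hZ : IsClosed Z := by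
    have c1 : Continuous fun z : (HermMat N × (V →L[ℝ] HermMat N)) × K => z.1.1.toMatrix :=
      continuous_toMatrix.comp (continuous_fst.fst)
    have c2 : Continuous fun z : (HermMat N × (V →L[ℝ] HermMat N)) × K => z.2.1.1 :=
      continuous_subtype_val.fst.comp continuous_snd
    have c3 : Continuous fun z : (HermMat N × (V →L[ℝ] HermMat N)) × K =>
        (z.1.2 z.2.1.2).toMatrix :=
      continuous_toMatrix.comp
        (continuous_fst.snd.clm_apply (continuous_subtype_val.snd.comp continuous_snd))
    have c4 := (c2.matrix_conjTranspose.matrix_mul c1).matrix_mul c2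
    have c5 := (c2.matrix_conjTranspose.matrix_mul c3).matrix_mul c2
    refine (isClosed_eq (c1.matrix_mul c2) ?_).inter (isClosed_eq c5 ?_)
    · exact (Complex.continuous_ofReal.comp
        (Complex.continuous_re.comp (c4.matrix_elem 0 0))).smul c2
    · exact (Complex.continuous_ofReal.comp
        (Complex.continuous_re.comp (c5.matrix_elem 0 0))).smul continuous_const
  have hcompl : {p : HermMat N × (V →L[ℝ] HermMat N) | p.1.IsTransverse p.2}ᶜ
      = Prod.fst '' Z := by
    ext p
    simp only [Set.mem_compl_iff, Set.mem_ofPred_eq, not_isTransverse_iff, Set.mem_image]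
    constructor
    · rintro ⟨W, v, h1, h2, h3, h4⟩
      exact ⟨(p, ⟨(W, v), h1, by simpa using h2⟩), ⟨h3, h4⟩, rfl⟩
    · rintro ⟨⟨p', ⟨⟨W, v⟩, h1, h2⟩⟩, ⟨h3, h4⟩, rfl⟩
      exact ⟨W, v, h1, by simpa using h2, h3, h4⟩
  rw [← isClosed_compl_iff, hcompl]
  exact isClosedMap_fst_of_compactSpace _ hZ

theorem isOpen_atMostOneDouble_and_isTransverse [FiniteDimensional ℝ V] :
    IsOpen {p : HermMat N × (V →L[ℝ] HermMat N) |
      p.1.AtMostOneDouble ∧ p.1.IsTransverse p.2} :=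
  (isOpen_atMostOneDouble.preimage continuous_fst).inter isOpen_isTransverse

theorem ae_forall_atMostOneDouble_and_isTransverse [FiniteDimensional ℝ V] {U : Set V}
    {F : V → HermMat N} (hV : finrank ℝ V = 3) (hF : ∀ x ∈ U, DifferentiableAt ℝ F x)
    (m : Measure (HermMat N)) [m.IsAddHaarMeasure] :
    ∀ᵐ B ∂m, ∀ x ∈ U, (F x + B).AtMostOneDouble ∧ (F x + B).IsTransverse (fderiv ℝ F x) := by
  filter_upwards [ae_forall_not_isEigenframe_three hV hF m,
    ae_forall_not_isEigenframe_two_two hV hF m, ae_forall_isTransverse hV hF m]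
    with B h3 h22 ht x hx
  refine ⟨?_, ht x hx⟩
  by_contra h
  rcases exists_eigenframes_of_not_atMostOneDouble h with ⟨W, μ, hW⟩ | ⟨W, W', μ, ν, hne, hW, hW'⟩
  · exact h3 x hx W μ hW
  · exact h22 x hx W W' μ ν hne hW hW'

/-! ### Eigenspaces of a double eigenvalue -/

theorem IsTransverse.comp {V' : Type*} [NormedAddCommGroup V'] [NormedSpace ℝ V'] {A : HermMat N}
    {D : V →L[ℝ] HermMat N} (h : A.IsTransverse D) {τ : V' →L[ℝ] V}
    (hτ : Function.Injective τ) : A.IsTransverse (D.comp τ) := by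
  intro W μ v hW hc
  exact hτ ((h W μ (τ v) hW hc).trans (map_zero τ).symm)

theorem conjTranspose_mul_apply_eq_zero {A : HermMat N} {U : Matrix (Fin N) (Fin N) ℂ}
    (hU : Uᴴ * U = 1) (hU' : U * Uᴴ = 1)
    (hA : A.toMatrix * U = U * diagonal (fun j => (A.eig j : ℂ))) {k : ℕ}
    {X : Matrix (Fin N) (Fin k) ℂ} {μ : ℝ} (hX : A.toMatrix * X = (μ : ℂ) • X) {i : Fin N}
    (hi : A.eig i ≠ μ) (a : Fin k) : (Uᴴ * X) i a = 0 := by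
  have h : diagonal (fun j => (A.eig j : ℂ)) * (Uᴴ * X) = (μ : ℂ) • (Uᴴ * X) := by
    calc diagonal (fun j => (A.eig j : ℂ)) * (Uᴴ * X)
        = Uᴴ * (U * diagonal (fun j => (A.eig j : ℂ))) * (Uᴴ * X) := by
          rw [← Matrix.mul_assoc Uᴴ U, hU, Matrix.one_mul]
      _ = Uᴴ * (A.toMatrix * ((U * Uᴴ) * X)) := by rw [← hA]; simp only [Matrix.mul_assoc]
      _ = (μ : ℂ) • (Uᴴ * X) := by rw [hU', Matrix.one_mul, hX, Matrix.mul_smul]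
  have h1 := congrFun (congrFun h i) a
  rw [diagonal_mul, Matrix.smul_apply, smul_eq_mul, ← sub_eq_zero, ← sub_mul] at h1
  refine (mul_eq_zero.mp h1).resolve_left ?_
  exact_mod_cast sub_ne_zero.mpr hi

/-- In an eigenbasis, only the rows of `W` indexed by eigenvalues equal to μ can be nonzero. With at
most one such row, two columns could not be orthonormal. -/
theorem IsEigenframe.exists_eig_eq {A : HermMat N} {W : Matrix (Fin N) (Fin 2) ℂ} {μ : ℝ}
    (h : A.IsEigenframe W μ) : ∃ i j, i < j ∧ A.eig i = μ ∧ A.eig j = μ := by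
  obtain ⟨U, hU, hU', hA⟩ := A.exists_unitary
  by_contra hcon
  push Not at hcon
  have huniq : ∀ i j, A.eig i = μ → A.eig j = μ → i = j := by
    intro i j hi hj
    rcases lt_trichotomy i j with hij | hij | hij
    · exact absurd hj (hcon i j hij hi)
    · exact hij
    · exact absurd hi (hcon j i hij hj)
  have hY : (Uᴴ * W)ᴴ * (Uᴴ * W) = 1 := by
    rw [conjTranspose_mul, conjTranspose_conjTranspose, Matrix.mul_assoc, ← Matrix.mul_assoc U,
      hU', Matrix.one_mul, h.1]
  set Y := Uᴴ * W
  have hz : ∀ i a, A.eig i ≠ μ → Y i a = 0 :=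
    fun i a hi => conjTranspose_mul_apply_eq_zero hU hU' hA h.2 hi a
  by_cases hex : ∃ i, A.eig i = μ
  · obtain ⟨i, hi⟩ := hex
    have hs : ∀ a b, star (Y i a) * Y i b = (1 : Matrix (Fin 2) (Fin 2) ℂ) a b := by
      intro a b
      rw [← hY, mul_apply, Finset.sum_eq_single i]
      · rfl
      · intro j _ hj
        rw [hz j b fun hj' => hj (huniq _ _ hj' hi), mul_zero]
      · simp
    have h00 := hs 0 0
    have h11 := hs 1 1
    have h01 := hs 0 1
    simp only [one_apply_eq] at h00 h11
    rw [one_apply_ne (by decide)] at h01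
    rcases mul_eq_zero.mp h01 with h0 | h0 <;> simp [h0] at h00 h11
  · push Not at hex
    have := congrFun (congrFun hY 0) 0
    rw [mul_apply] at this
    simp [hz _ _ (hex _)] at this

/-- If `μ` is an exactly double eigenvalue of `A`, then every eigenvector lies in the span of any
orthonormal frame of two eigenvectors. -/
theorem IsEigenframe.eq_mul_mul {A : HermMat N} {W : Matrix (Fin N) (Fin 2) ℂ} {μ : ℝ}
    (h : A.IsEigenframe W μ) {n m : Fin N} (hne : ∀ j, j ≠ n → j ≠ m → A.eig j ≠ μ)
    (hnm : n ≠ m) {k : ℕ}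
    {X : Matrix (Fin N) (Fin k) ℂ} (hX : A.toMatrix * X = (μ : ℂ) • X) : W * (Wᴴ * X) = X := by
  obtain ⟨U, hU, hU', hA⟩ := A.exists_unitary
  set P := U.submatrix id ![n, m]
  have hP : ∀ {k : ℕ} {X : Matrix (Fin N) (Fin k) ℂ}, A.toMatrix * X = (μ : ℂ) • X →
      P * (Pᴴ * X) = X := by
    intro k X hX
    conv_rhs => rw [← Matrix.one_mul X, ← hU', Matrix.mul_assoc]
    ext i a
    rw [mul_apply, mul_apply, Fin.sum_univ_two, ← Finset.sum_subset (Finset.subset_univ {n, m}),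
      Finset.sum_pair hnm]
    · rfl
    · intro j _ hj
      simp only [Finset.mem_insert, Finset.mem_singleton, not_or] at hj
      rw [conjTranspose_mul_apply_eq_zero hU hU' hA hX (hne j hj.1 hj.2), mul_zero]
  -- The change of frame from `P` to `W` is a square isometry, hence unitary, so both frames define
  -- the same projection.
  have hC : (Pᴴ * W)ᴴ * (Pᴴ * W) = 1 := by
    rw [conjTranspose_mul, conjTranspose_conjTranspose, Matrix.mul_assoc, hP h.2, h.1]
  have hC' := mul_eq_one_comm.mp hC
  calc W * (Wᴴ * X) = P * (Pᴴ * W) * ((P * (Pᴴ * W))ᴴ * X) := by rw [hP h.2]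
    _ = P * ((Pᴴ * W) * (Pᴴ * W)ᴴ) * (Pᴴ * X) := by
      simp only [conjTranspose_mul, conjTranspose_conjTranspose, Matrix.mul_assoc]
    _ = X := by rw [hC', Matrix.mul_one, hP hX]

end HermMat

/-- A matrix similar to a diagonal matrix has the same trace and determinant. -/
theorem trace_det_eq_of_mul_eq_mul_diagonal {M C : Matrix (Fin 2) (Fin 2) ℂ} {a b : ℂ}
    {D : Matrix (Fin 2) (Fin 2) ℂ} (hD : D * C = 1) (h : M * C = C * diagonal ![a, b]) :
    M.trace = a + b ∧ M.det = a * b := by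
  have hD' := mul_eq_one_comm.mp hD
  have hM : M = C * diagonal ![a, b] * D := by
    rw [← h, Matrix.mul_assoc, hD', Matrix.mul_one]
  constructor
  · rw [hM, trace_mul_comm, ← Matrix.mul_assoc, hD, Matrix.one_mul, trace_diagonal]
    simp
  · rw [hM, det_mul, det_mul, mul_comm, ← mul_assoc, ← det_mul, hD, det_one, one_mul,
      det_diagonal]
    simp

/-! ### Analytic continuation of a double eigenspace -/

namespace HermMat

variable {N : ℕ}

/-- The equation for an invariant frame `W` of `A`, normalised by `W₀ᴴ * W = 1`, and the matrix `M`
of `A` in this frame. -/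
def invariantFrameEq (W₀ : Matrix (Fin N) (Fin 2) ℂ)
    (p : HermMat N × Matrix (Fin N) (Fin 2) ℂ × Matrix (Fin 2) (Fin 2) ℂ) :
    Matrix (Fin N) (Fin 2) ℂ × Matrix (Fin 2) (Fin 2) ℂ :=
  (p.1.toMatrix * p.2.1 - p.2.1 * p.2.2, W₀ᴴ * p.2.1 - 1)

theorem contDiff_invariantFrameEq (W₀ : Matrix (Fin N) (Fin 2) ℂ) :
    ContDiff ℝ ω (invariantFrameEq W₀) := by
  have h1 : ContDiff ℝ ω fun p : HermMat N × Matrix (Fin N) (Fin 2) ℂ × Matrix (Fin 2) (Fin 2) ℂ =>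
      p.1.toMatrix := (toMatrixL N).contDiff.comp contDiff_fst
  exact ((h1.matrix_mul contDiff_snd.fst).sub (contDiff_snd.fst.matrix_mul contDiff_snd.snd)).prodMk
    ((contDiff_const.matrix_mul contDiff_snd.fst).sub contDiff_const)

theorem fderiv_invariantFrameEq_inr (W₀ : Matrix (Fin N) (Fin 2) ℂ)
    (p : HermMat N × Matrix (Fin N) (Fin 2) ℂ × Matrix (Fin 2) (Fin 2) ℂ)
    (v : Matrix (Fin N) (Fin 2) ℂ × Matrix (Fin 2) (Fin 2) ℂ) :
    fderiv ℝ (invariantFrameEq W₀) p (0, v) =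
      (p.1.toMatrix * v.1 - (p.2.1 * v.2 + v.1 * p.2.2), W₀ᴴ * v.1) := by
  have h0 : HasFDerivAt
      (fun p : HermMat N × Matrix (Fin N) (Fin 2) ℂ × Matrix (Fin 2) (Fin 2) ℂ => p.1.toMatrix)
      ((toMatrixL N).comp (ContinuousLinearMap.fst ℝ _ _)) p :=
    (toMatrixL N).hasFDerivAt.comp p hasFDerivAt_fst
  have h1 : HasFDerivAt
      (fun p : HermMat N × Matrix (Fin N) (Fin 2) ℂ × Matrix (Fin 2) (Fin 2) ℂ => p.2.1)
      ((ContinuousLinearMap.fst ℝ _ _).comp (ContinuousLinearMap.snd ℝ _ _)) p :=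
    hasFDerivAt_snd.fst
  have h2 : HasFDerivAt
      (fun p : HermMat N × Matrix (Fin N) (Fin 2) ℂ × Matrix (Fin 2) (Fin 2) ℂ => p.2.2)
      ((ContinuousLinearMap.snd ℝ _ _).comp (ContinuousLinearMap.snd ℝ _ _)) p :=
    hasFDerivAt_snd.snd
  have h3 := ((h0.matrix_mul h1).sub (h1.matrix_mul h2)).prodMk
    (((hasFDerivAt_const W₀ᴴ p).matrix_mul h1).sub_const 1)
  have h4 : fderiv ℝ (invariantFrameEq W₀) p = _ := h3.fderiv
  rw [h4]
  change ((p.1.toMatrix * v.1 + (0 : Matrix (Fin N) (Fin N) ℂ) * p.2.1)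
    - (p.2.1 * v.2 + v.1 * p.2.2), W₀ᴴ * v.1 + (0 : Matrix (Fin 2) (Fin N) ℂ) * p.2.1) = _
  simp

/-- Source and target coincide, so injectivity suffices. Applying W₀ᴴ to (A₀ - μ) X = W₀ Y with W₀ᴴ
X = 0 gives Y = 0. Then the columns of X lie in the eigenspace and are orthogonal to it, so X = 0.
-/
theorem isInvertible_fderiv_invariantFrameEq {A₀ : HermMat N} {W₀ : Matrix (Fin N) (Fin 2) ℂ}
    {μ : ℝ} (h : A₀.IsEigenframe W₀ μ) {n m : Fin N}
    (hne : ∀ j, j ≠ n → j ≠ m → A₀.eig j ≠ μ) (hnm : n ≠ m) :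
    (fderiv ℝ (invariantFrameEq W₀) (A₀, W₀, (μ : ℂ) • 1) ∘L
      .inr ℝ (HermMat N) _).IsInvertible := by
  set D := fderiv ℝ (invariantFrameEq W₀) (A₀, W₀, (μ : ℂ) • 1) ∘L
      ContinuousLinearMap.inr ℝ (HermMat N) _ with hD
  have hinj : Function.Injective D.toLinearMap := by
    rw [← LinearMap.ker_eq_bot, LinearMap.ker_eq_bot']
    rintro ⟨X, Y⟩ hv
    have hv' : fderiv ℝ (invariantFrameEq W₀) (A₀, W₀, (μ : ℂ) • 1) (0, (X, Y)) = 0 := hv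
    rw [fderiv_invariantFrameEq_inr] at hv'
    obtain ⟨e1, e2⟩ := Prod.ext_iff.mp hv'
    simp only [Prod.fst_zero, Prod.snd_zero, Matrix.mul_smul, Matrix.mul_one] at e1 e2
    have e3 : W₀ᴴ * A₀.toMatrix = (μ : ℂ) • W₀ᴴ := by
      have := congrArg conjTranspose h.2
      rw [conjTranspose_mul, A₀.isHermitian.eq, conjTranspose_smul] at this
      simpa using this
    have hY : Y = 0 := by
      have := congrArg (fun Z => W₀ᴴ * Z) e1
      simp only [Matrix.mul_sub, Matrix.mul_add, ← Matrix.mul_assoc, e3, h.1, Matrix.smul_mul,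
        Matrix.mul_smul, e2, Matrix.one_mul, Matrix.mul_zero, smul_zero, add_zero, zero_sub,
        neg_eq_zero] at this
      exact this
    have hX : X = 0 := by
      rw [hY, Matrix.mul_zero, zero_add, sub_eq_zero] at e1
      rw [← h.eq_mul_mul hne hnm e1, e2, Matrix.mul_zero]
    rw [hX, hY]
    rfl
  exact ⟨(LinearEquiv.ofInjectiveEndo D.toLinearMap hinj).toContinuousLinearEquiv,
    ContinuousLinearMap.ext fun _ => rfl⟩

end HermMat

/-- The second derivative of `Re (f² + g h)` at a common zero of `f`, `g` and `h`. -/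
theorem fderiv_fderiv_re_mul_self_add_mul {V : Type*} [NormedAddCommGroup V] [NormedSpace ℝ V]
    {f g h : V → ℂ} {y : V} (hf : ContDiffAt ℝ 2 f y) (hg : ContDiffAt ℝ 2 g y)
    (hh : ContDiffAt ℝ 2 h y) (hf0 : f y = 0) (hg0 : g y = 0) (hh0 : h y = 0) (v w : V) :
    fderiv ℝ (fderiv ℝ fun x => (f x * f x + g x * h x).re) y v w =
      (2 * (fderiv ℝ f y v * fderiv ℝ f y w) + (fderiv ℝ g y v * fderiv ℝ h y w +
        fderiv ℝ h y v * fderiv ℝ g y w)).re := by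
  have hd : ∀ {k : V → ℂ}, ContDiffAt ℝ 2 k y → ∀ᶠ x in 𝓝 y, DifferentiableAt ℝ k x := by
    intro k hk
    filter_upwards [hk.eventually (by simp)] with x hx using hx.differentiableAt (by simp)
  have hd2 : ∀ {k : V → ℂ}, ContDiffAt ℝ 2 k y → DifferentiableAt ℝ (fderiv ℝ k) y := fun hk =>
    (hk.fderiv_right (m := 1) (by norm_num)).differentiableAt (by simp)
  have e1 : (fderiv ℝ fun x => (f x * f x + g x * h x).re) =ᶠ[𝓝 y] fun x =>
      Complex.reCLM.comp ((f x • fderiv ℝ f x + f x • fderiv ℝ f x) +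
        (g x • fderiv ℝ h x + h x • fderiv ℝ g x)) := by
    filter_upwards [hd hf, hd hg, hd hh] with x hfx hgx hhx
    exact (Complex.reCLM.hasFDerivAt.comp x ((hfx.hasFDerivAt.mul hfx.hasFDerivAt).add
      (hgx.hasFDerivAt.mul hhx.hasFDerivAt))).fderiv
  -- Terms containing a second derivative carry a factor that vanishes at `y`, so only products of
  -- first derivatives survive.
  have hp : ∀ {k l : V → ℂ}, ContDiffAt ℝ 2 k y → ContDiffAt ℝ 2 l y → k y = 0 →
      HasFDerivAt (fun x => k x • fderiv ℝ l x)
        ((fderiv ℝ k y).smulRight (fderiv ℝ l y)) y := by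
    intro k l hk hl hk0
    refine (((hk.differentiableAt (by simp)).hasFDerivAt.smul
      (hd2 hl).hasFDerivAt)).congr_fderiv ?_
    rw [hk0, zero_smul, zero_add]
  have e2 := ((hp hf hf hf0).add (hp hf hf hf0)).add ((hp hg hh hg0).add (hp hh hg hh0))
  have e3 := (ContinuousLinearMap.compL ℝ V ℂ ℝ Complex.reCLM).hasFDerivAt.comp y e2
  have e4 : HasFDerivAt (fderiv ℝ fun x => (f x * f x + g x * h x).re) _ y :=
    e3.congr_of_eventuallyEq e1
  rw [e4.fderiv]
  change (((fderiv ℝ f y v * fderiv ℝ f y w + fderiv ℝ f y v * fderiv ℝ f y w) +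
    (fderiv ℝ g y v * fderiv ℝ h y w + fderiv ℝ h y v * fderiv ℝ g y w)) : ℂ).re = _
  rw [two_mul]

/-- The evaluation of matrices at an entry. -/
def entryL {m n : Type*} [Fintype m] [Fintype n] (i : m) (j : n) : Matrix m n ℂ →L[ℝ] ℂ :=
  LinearMap.toContinuousLinearMap (Matrix.entryLinearMap ℝ ℂ i j)

@[simp]
theorem entryL_apply {m n : Type*} [Fintype m] [Fintype n] (i : m) (j : n) (M : Matrix m n ℂ) :
    entryL i j M = M i j := rfl

namespace HermMat

variable {N : ℕ} {A₀ : HermMat N} {W₀ : Matrix (Fin N) (Fin 2) ℂ} {μ : ℝ} {n m : Fin N}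

/-- The implicit function theorem applies to `invariantFrameEq`. The frame `W A` is normalised
against `W₀` and need not be orthonormal, so `M A` need not be Hermitian; hence only its trace and
determinant are compared with eigenvalues. -/
theorem IsEigenframe.exists_invariant_frame (h : A₀.IsEigenframe W₀ μ)
    (hne : ∀ j, j ≠ n → j ≠ m → A₀.eig j ≠ μ) (hnm : n ≠ m) :
    ∃ (W : HermMat N → Matrix (Fin N) (Fin 2) ℂ) (M : HermMat N → Matrix (Fin 2) (Fin 2) ℂ),
      ContDiffAt ℝ ω W A₀ ∧ ContDiffAt ℝ ω M A₀ ∧ W A₀ = W₀ ∧ M A₀ = (μ : ℂ) • 1 ∧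
      ∀ᶠ A in 𝓝 A₀, A.toMatrix * W A = W A * M A ∧ W₀ᴴ * W A = 1 := by
  have cdf := (contDiff_invariantFrameEq W₀).contDiffAt (x := (A₀, W₀, (μ : ℂ) • 1))
  have hinv := isInvertible_fderiv_invariantFrameEq h hne hnm
  have hω : (ω : WithTop ℕ∞) ≠ 0 := by simp
  have hval := cdf.implicitFunction_apply_self hω hinv
  have hsmooth := cdf.contDiffAt_implicitFunction hω hinv
  have hev := cdf.eventually_apply_implicitFunction hω hinv
  have h0 : invariantFrameEq W₀ (A₀, W₀, (μ : ℂ) • 1) = 0 := by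
    simp [invariantFrameEq, h.1, h.2]
  refine ⟨fun A => (cdf.implicitFunction hω hinv A).1, fun A => (cdf.implicitFunction hω hinv A).2,
    hsmooth.fst, hsmooth.snd, congrArg Prod.fst hval, congrArg Prod.snd hval, ?_⟩
  filter_upwards [hev] with A hA
  rw [h0] at hA
  obtain ⟨e1, e2⟩ := Prod.ext_iff.mp hA
  exact ⟨sub_eq_zero.mp e1, sub_eq_zero.mp e2⟩

variable {W : HermMat N → Matrix (Fin N) (Fin 2) ℂ} {M : HermMat N → Matrix (Fin 2) (Fin 2) ℂ}

/-- Near A₀ one has M = W₀ᴴ (A - μ) W + μ. Since W₀ᴴ (A₀ - μ) = 0, the unknown derivative of W drops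
out. -/
theorem IsEigenframe.hasFDerivAt_of_invariant_frame (h : A₀.IsEigenframe W₀ μ)
    (hW : ContDiffAt ℝ ω W A₀) (hW₀ : W A₀ = W₀)
    (hev : ∀ᶠ A in 𝓝 A₀, A.toMatrix * W A = W A * M A ∧ W₀ᴴ * W A = 1) :
    HasFDerivAt M ((toMatrixL 2).comp (compress W₀)) A₀ := by
  have hG : HasFDerivAt (fun A : HermMat N => A.toMatrix - (μ : ℂ) • 1) (toMatrixL N) A₀ :=
    (toMatrixL N).hasFDerivAt.sub_const _
  have h1 := ((hasFDerivAt_const W₀ᴴ A₀).matrix_mul hG).matrix_mul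
    (hW.differentiableAt (by simp)).hasFDerivAt
  have e3 : W₀ᴴ * (A₀.toMatrix - (μ : ℂ) • 1) = 0 := by
    have := congrArg conjTranspose h.2
    rw [conjTranspose_mul, A₀.isHermitian.eq, conjTranspose_smul] at this
    rw [Matrix.mul_sub, this]
    simp
  have h2 : HasFDerivAt
      (fun A => W₀ᴴ * (A.toMatrix - (μ : ℂ) • 1) * W A + (μ : ℂ) • (1 : Matrix (Fin 2) (Fin 2) ℂ))
      ((toMatrixL 2).comp (compress W₀)) A₀ := by
    refine (h1.add_const _).congr_fderiv ?_
    ext1 v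
    change W₀ᴴ * (A₀.toMatrix - (μ : ℂ) • 1) * fderiv ℝ W A₀ v +
      (W₀ᴴ * v.toMatrix + (0 : Matrix (Fin 2) (Fin N) ℂ) * (A₀.toMatrix - (μ : ℂ) • 1)) * W A₀
      = W₀ᴴ * v.toMatrix * W₀
    rw [e3, hW₀, Matrix.zero_mul, Matrix.zero_mul, zero_add, add_zero]
  refine h2.congr_of_eventuallyEq ?_
  filter_upwards [hev] with A hA
  rw [Matrix.mul_assoc, Matrix.sub_mul, hA.1, Matrix.mul_sub, ← Matrix.mul_assoc, hA.2,
    Matrix.smul_mul, Matrix.mul_smul, Matrix.one_mul, Matrix.one_mul, hA.2]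
  abel

/-- The invariant frame eventually contains all eigenvectors with eigenvalue close to `μ`. -/
theorem IsEigenframe.eventually_eq_mul_mul (h : A₀.IsEigenframe W₀ μ)
    (hne : ∀ j, j ≠ n → j ≠ m → A₀.eig j ≠ μ) (hnm : n ≠ m)
    (hW : ContDiffAt ℝ ω W A₀) (hW₀ : W A₀ = W₀)
    (hev : ∀ᶠ A in 𝓝 A₀, A.toMatrix * W A = W A * M A ∧ W₀ᴴ * W A = 1) {l : Fin N}
    (hl : A₀.eig l = μ) :
    ∀ᶠ A in 𝓝 A₀, ∀ X : Matrix (Fin N) (Fin 1) ℂ, A.toMatrix * X = (A.eig l : ℂ) • X →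
      W A * (W₀ᴴ * X) = X := by
  -- `S A` is designed to kill the defect X - W W₀ᴴ X of every eigenvector X. At `A₀` it equals A₀ -
  -- μ + W₀ W₀ᴴ, which is invertible, so nearby the defect must vanish.
  let S : HermMat N → Matrix (Fin N) (Fin N) ℂ := fun A =>
    (1 - W A * W₀ᴴ) * (A.toMatrix - (A.eig l : ℂ) • 1) + W₀ * W₀ᴴ
  have hS : ContinuousAt S A₀ := by
    have c1 := hW.continuousAt
    have c2 : ContinuousAt (fun A : HermMat N => A.toMatrix) A₀ := continuous_toMatrix.continuousAt
    have c3 : ContinuousAt (fun A : HermMat N => (A.eig l : ℂ)) A₀ :=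
      (Complex.continuous_ofReal.comp (continuous_eig l)).continuousAt
    let g : Matrix (Fin N) (Fin 2) ℂ × Matrix (Fin N) (Fin N) ℂ × ℂ → Matrix (Fin N) (Fin N) ℂ :=
      fun p => (1 - p.1 * W₀ᴴ) * (p.2.1 - p.2.2 • (1 : Matrix (Fin N) (Fin N) ℂ)) + W₀ * W₀ᴴ
    have hg : Continuous g :=
      ((continuous_const.sub (continuous_fst.matrix_mul continuous_const)).matrix_mul
        (continuous_snd.fst.sub (continuous_snd.snd.smul continuous_const))).add continuous_const
    have c4 := c1.prodMk (c2.prodMk c3)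
    have hSg : S = g ∘ fun A => (W A, A.toMatrix, (A.eig l : ℂ)) := rfl
    rw [hSg]
    exact hg.continuousAt.comp c4
  have hS0 : (S A₀).det ≠ 0 := by
    intro hdet
    obtain ⟨x, hx0, hx⟩ := exists_mulVec_eq_zero_iff.mpr hdet
    apply hx0
    let X : Matrix (Fin N) (Fin 1) ℂ := Matrix.of fun i _ => x i
    have hSX : S A₀ * X = 0 := by
      ext i a
      exact congrFun hx i
    have e3 : W₀ᴴ * A₀.toMatrix = (μ : ℂ) • W₀ᴴ := by
      have := congrArg conjTranspose h.2
      rw [conjTranspose_mul, A₀.isHermitian.eq, conjTranspose_smul] at this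
      simpa using this
    have e4 : S A₀ = (A₀.toMatrix - (μ : ℂ) • 1) + W₀ * W₀ᴴ := by
      have : W₀ * W₀ᴴ * (A₀.toMatrix - (μ : ℂ) • 1) = 0 := by
        rw [Matrix.mul_assoc, Matrix.mul_sub, e3]
        simp
      simp only [S, hW₀, hl, Matrix.sub_mul (1 : Matrix (Fin N) (Fin N) ℂ), Matrix.one_mul, this,
        sub_zero]
    have e5 : W₀ᴴ * X = 0 := by
      have := congrArg (fun Z => W₀ᴴ * Z) hSX
      simp only [e4, ← Matrix.mul_assoc, Matrix.mul_add, Matrix.mul_sub, e3, h.1, Matrix.one_mul,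
        Matrix.mul_smul, Matrix.mul_one, sub_self, zero_add, Matrix.mul_zero] at this
      exact this
    have e6 : A₀.toMatrix * X = (μ : ℂ) • X := by
      rw [e4, Matrix.add_mul, Matrix.mul_assoc, e5, Matrix.mul_zero, add_zero, Matrix.sub_mul,
        sub_eq_zero] at hSX
      rw [hSX, Matrix.smul_mul, Matrix.one_mul]
    have hX : X = 0 := by rw [← h.eq_mul_mul hne hnm e6, e5, Matrix.mul_zero]
    ext i
    exact congrFun (congrFun hX i) 0
  have hdet : ∀ᶠ A in 𝓝 A₀, (S A).det ≠ 0 :=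
    (Continuous.continuousAt (f := fun Z : Matrix (Fin N) (Fin N) ℂ => Z.det)
      (by fun_prop)).comp hS |>.eventually_ne hS0
  filter_upwards [hev, hdet] with A hA hAdet X hX
  set Y := X - W A * (W₀ᴴ * X)
  have hY1 : W₀ᴴ * Y = 0 := by
    rw [Matrix.mul_sub, ← Matrix.mul_assoc, hA.2, Matrix.one_mul, sub_self]
  have hY2 : (A.toMatrix - (A.eig l : ℂ) • 1) * Y
      = -(W A * ((M A - (A.eig l : ℂ) • 1) * (W₀ᴴ * X))) := by
    have e1 : (A.toMatrix - (A.eig l : ℂ) • 1) * X = 0 := by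
      rw [Matrix.sub_mul, hX]
      simp
    have e2 : (A.toMatrix - (A.eig l : ℂ) • 1) * W A = W A * (M A - (A.eig l : ℂ) • 1) := by
      rw [Matrix.sub_mul, hA.1, Matrix.mul_sub]
      simp
    rw [Matrix.mul_sub, e1, ← Matrix.mul_assoc, e2, zero_sub, Matrix.mul_assoc]
  have hY3 : S A * Y = 0 := by
    have : (1 - W A * W₀ᴴ) * W A = 0 := by
      rw [Matrix.sub_mul, Matrix.mul_assoc, hA.2]
      simp
    simp only [S]
    rw [Matrix.add_mul, Matrix.mul_assoc, hY2, Matrix.mul_assoc W₀, hY1, Matrix.mul_zero, add_zero,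
      Matrix.mul_neg, ← Matrix.mul_assoc, this, Matrix.zero_mul, neg_zero]
  have hY : Y = 0 := by
    rw [← nonsing_inv_mul_cancel_left (S A) Y (isUnit_iff_ne_zero.mpr hAdet), hY3, Matrix.mul_zero]
  exact (sub_eq_zero.mp hY).symm

/-- Orthonormal eigenvectors P numbered n and m lie in the span of the columns of `W A`, so W₀ᴴ P,
with left inverse Pᴴ W, conjugates `M A` to the diagonal matrix of the two eigenvalues. -/
theorem IsEigenframe.eventually_trace_det (h : A₀.IsEigenframe W₀ μ)
    (hne : ∀ j, j ≠ n → j ≠ m → A₀.eig j ≠ μ) (hnm : n ≠ m) (hn : A₀.eig n = μ)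
    (hm : A₀.eig m = μ) (hW : ContDiffAt ℝ ω W A₀) (hW₀ : W A₀ = W₀)
    (hev : ∀ᶠ A in 𝓝 A₀, A.toMatrix * W A = W A * M A ∧ W₀ᴴ * W A = 1) :
    ∀ᶠ A in 𝓝 A₀, (M A).trace = (A.eig n : ℂ) + A.eig m ∧
      (M A).det = (A.eig n : ℂ) * A.eig m := by
  filter_upwards [hev, h.eventually_eq_mul_mul hne hnm hW hW₀ hev hn,
    h.eventually_eq_mul_mul hne hnm hW hW₀ hev hm] with A hA hAn hAm
  obtain ⟨U, hU, -, hAU⟩ := A.exists_unitary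
  have hcol : ∀ l, A.toMatrix * (U.submatrix id fun _ : Fin 1 => l)
      = (A.eig l : ℂ) • U.submatrix id fun _ : Fin 1 => l := by
    intro l
    have : A.toMatrix * (U.submatrix id fun _ : Fin 1 => l)
        = (A.toMatrix * U).submatrix id fun _ : Fin 1 => l := by
      ext i j
      simp [mul_apply]
    rw [this, hAU]
    ext i j
    simp [mul_diagonal, mul_comm]
  set P := U.submatrix id ![n, m]
  have hP : Pᴴ * P = 1 := by
    have : Pᴴ * P = (Uᴴ * U).submatrix ![n, m] ![n, m] := rfl
    rw [this, hU, submatrix_one]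
    intro x y hxy
    fin_cases x <;> fin_cases y <;> simp_all [hnm.symm]
  have hWP : W A * (W₀ᴴ * P) = P := by
    ext i j
    fin_cases j
    · exact congrFun (congrFun (hAn _ (hcol n)) i) 0
    · exact congrFun (congrFun (hAm _ (hcol m)) i) 0
  have hAP : A.toMatrix * P = P * diagonal ![(A.eig n : ℂ), (A.eig m : ℂ)] := by
    ext i j
    rw [mul_diagonal, mul_comm (P i j)]
    fin_cases j
    · exact congrFun (congrFun (hcol n) i) 0
    · exact congrFun (congrFun (hcol m) i) 0
  refine trace_det_eq_of_mul_eq_mul_diagonal (C := W₀ᴴ * P) (D := Pᴴ * W A) ?_ ?_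
  · rw [Matrix.mul_assoc, hWP, hP]
  · calc M A * (W₀ᴴ * P) = W₀ᴴ * W A * (M A * (W₀ᴴ * P)) := by rw [hA.2, Matrix.one_mul]
      _ = W₀ᴴ * (W A * M A * (W₀ᴴ * P)) := by simp only [Matrix.mul_assoc]
      _ = W₀ᴴ * (A.toMatrix * (W A * (W₀ᴴ * P))) := by rw [← hA.1, Matrix.mul_assoc]
      _ = _ := by rw [hWP, hAP, Matrix.mul_assoc]

end HermMat

/-! ### The discriminant and its Hessian -/

/-- Half the difference of the diagonal entries. -/
def halfDiffL : Matrix (Fin 2) (Fin 2) ℂ →L[ℝ] ℂ := (1 / 2 : ℝ) • (entryL 0 0 - entryL 1 1)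

theorem halfDiffL_apply (M : Matrix (Fin 2) (Fin 2) ℂ) : halfDiffL M = (M 0 0 - M 1 1) / 2 := by
  change ((1 / 2 : ℝ) : ℂ) * (M 0 0 - M 1 1) = _
  push_cast
  ring

theorem halfDiffL_mul_self_add (M : Matrix (Fin 2) (Fin 2) ℂ) :
    halfDiffL M * halfDiffL M + M 0 1 * M 1 0 = (M.trace / 2) ^ 2 - M.det := by
  rw [halfDiffL_apply, trace_fin_two, det_fin_two]
  ring

namespace HermMat

/-- The Hessian form of the discriminant of Hermitian `2 × 2` matrices is definite on the
traceless matrices. -/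
theorem forall_re_eq_zero_iff_exists_eq_smul_one {V : Type*} (B : V → HermMat 2) (v : V) :
    (∀ w, (2 * (halfDiffL (B v).toMatrix * halfDiffL (B w).toMatrix) +
      ((B v).toMatrix 0 1 * (B w).toMatrix 1 0 +
        (B v).toMatrix 1 0 * (B w).toMatrix 0 1)).re = 0) ↔
    ∃ c : ℝ, (B v).toMatrix = (c : ℂ) • 1 := by
  constructor
  · intro h
    -- Testing with w = v gives (a - d)²/2 + 2|b|² = 0 for the diagonal entries a, d and the
    -- off-diagonal entry b.
    have hv := h v
    have h10 : (B v).toMatrix 1 0 = star ((B v).toMatrix 0 1) :=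
      ((B v).isHermitian.apply 1 0).symm
    have h00 : ((B v).toMatrix 0 0).im = 0 := by
      have := congrArg Complex.im ((B v).isHermitian.apply 0 0)
      simp only [RCLike.star_def, Complex.conj_im] at this
      linarith
    have h11 : ((B v).toMatrix 1 1).im = 0 := by
      have := congrArg Complex.im ((B v).isHermitian.apply 1 1)
      simp only [RCLike.star_def, Complex.conj_im] at this
      linarith
    rw [h10, halfDiffL_apply] at hv
    simp only [RCLike.star_def, Complex.add_re, Complex.mul_re, Complex.re_ofNat, Complex.im_ofNat,
      Complex.conj_re, Complex.conj_im, Complex.div_ofNat_re, Complex.div_ofNat_im,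
      Complex.sub_re, Complex.sub_im, h00, h11] at hv
    have hsq : (((B v).toMatrix 0 0).re - ((B v).toMatrix 1 1).re) ^ 2 / 2
        + 2 * ((B v).toMatrix 0 1).re ^ 2 + 2 * ((B v).toMatrix 0 1).im ^ 2 = 0 := by
      rw [← hv]
      ring
    have p1 := sq_nonneg (((B v).toMatrix 0 0).re - ((B v).toMatrix 1 1).re)
    have p2 := sq_nonneg ((B v).toMatrix 0 1).re
    have p3 := sq_nonneg ((B v).toMatrix 0 1).im
    have hd : ((B v).toMatrix 0 0).re - ((B v).toMatrix 1 1).re = 0 :=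
      pow_eq_zero_iff two_ne_zero |>.mp (by linarith)
    have hr : ((B v).toMatrix 0 1).re = 0 := pow_eq_zero_iff two_ne_zero |>.mp (by linarith)
    have hi : ((B v).toMatrix 0 1).im = 0 := pow_eq_zero_iff two_ne_zero |>.mp (by linarith)
    have h01 : (B v).toMatrix 0 1 = 0 := Complex.ext hr hi
    refine ⟨((B v).toMatrix 0 0).re, ?_⟩
    ext i j
    fin_cases i <;> fin_cases j
    · apply Complex.ext <;> simp [h00]
    · simpa using h01
    · simp [h10, h01]
    · apply Complex.ext
      · simp
        linarith
      · simp [h11]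
  · rintro ⟨c, hc⟩ w
    simp [hc, halfDiffL_apply]

variable {N : ℕ} {A₀ : HermMat N} {W₀ : Matrix (Fin N) (Fin 2) ℂ} {μ : ℝ} {n m : Fin N}

/-- Near a matrix with an exactly double eigenvalue, the mean and the squared half-difference of
the two corresponding eigenvalues are analytic. -/
theorem IsEigenframe.exists_local_form {V : Type*} [NormedAddCommGroup V] [NormedSpace ℝ V]
    (h : A₀.IsEigenframe W₀ μ) (hne : ∀ j, j ≠ n → j ≠ m → A₀.eig j ≠ μ) (hnm : n ≠ m)
    (hn : A₀.eig n = μ) (hm : A₀.eig m = μ) :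
    ∃ ℓ q : HermMat N → ℝ, ContDiffAt ℝ ω ℓ A₀ ∧ ContDiffAt ℝ ω q A₀ ∧
      (∀ᶠ A in 𝓝 A₀, ℓ A = (A.eig n + A.eig m) / 2 ∧ q A = ((A.eig m - A.eig n) / 2) ^ 2) ∧
      ∀ (F : V → HermMat N) (y : V), ContDiffAt ℝ 2 F y → F y = A₀ → ∀ v,
        (∀ w, fderiv ℝ (fderiv ℝ fun x => q (F x)) y v w = 0) ↔
          ∃ c : ℝ, W₀ᴴ * (fderiv ℝ F y v).toMatrix * W₀ = (c : ℂ) • 1 := by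
  obtain ⟨W, M, hW, hM, hW₀, hM₀, hev⟩ := h.exists_invariant_frame hne hnm
  have htd := h.eventually_trace_det hne hnm hn hm hW hW₀ hev
  have hM' := h.hasFDerivAt_of_invariant_frame hW hW₀ hev
  have hk : ∀ k : Matrix (Fin 2) (Fin 2) ℂ →L[ℝ] ℂ, ContDiffAt ℝ ω (fun A => k (M A)) A₀ :=
    fun k => k.contDiff.contDiffAt.comp A₀ hM
  -- The second witness is (tr M / 2)² - det M, written as f² + gh with f, g, h vanishing at `A₀`,
  -- the shape required for the Hessian formula.
  refine ⟨fun A => ((M A).trace / 2).re,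
    fun A => (halfDiffL (M A) * halfDiffL (M A) + M A 0 1 * M A 1 0).re, ?_, ?_, ?_, ?_⟩
  · simp_rw [trace_fin_two]
    exact Complex.reCLM.contDiff.contDiffAt.comp A₀
      (((hk (entryL 0 0)).add (hk (entryL 1 1))).div_const 2)
  · exact Complex.reCLM.contDiff.contDiffAt.comp A₀
      (((hk halfDiffL).mul (hk halfDiffL)).add ((hk (entryL 0 1)).mul (hk (entryL 1 0))))
  · filter_upwards [htd] with A hA
    rw [halfDiffL_mul_self_add, hA.1, hA.2]
    constructor
    · rw [← Complex.ofReal_add, ← Complex.ofReal_ofNat, ← Complex.ofReal_div, Complex.ofReal_re]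
    · have : (((A.eig n : ℂ) + A.eig m) / 2) ^ 2 - (A.eig n : ℂ) * A.eig m
          = (((A.eig m - A.eig n) / 2) ^ 2 : ℝ) := by
        push_cast
        ring
      rw [this, Complex.ofReal_re]
  · intro F y hF hFy v
    subst hFy
    have hkF : ∀ k : Matrix (Fin 2) (Fin 2) ℂ →L[ℝ] ℂ,
        ContDiffAt ℝ 2 (fun x => k (M (F x))) y := fun k =>
      ((hk k).of_le (by exact_mod_cast le_top)).comp y hF
    have hkF' : ∀ (k : Matrix (Fin 2) (Fin 2) ℂ →L[ℝ] ℂ) (w : V),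
        fderiv ℝ (fun x => k (M (F x))) y w
          = k (compress W₀ (fderiv ℝ F y w)).toMatrix := by
      intro k w
      have hd : HasFDerivAt F (fderiv ℝ F y) y := (hF.differentiableAt (by simp)).hasFDerivAt
      have := (k.hasFDerivAt (x := M (F y))).comp y (hM'.comp y hd)
      exact congrArg (fun f => f w) this.fderiv
    have hess := fun w => fderiv_fderiv_re_mul_self_add_mul (hkF halfDiffL) (hkF (entryL 0 1))
      (hkF (entryL 1 0)) (by simp [halfDiffL_apply, hM₀]) (by simp [hM₀]) (by simp [hM₀]) v w
    have h01 := hkF' (entryL 0 1)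
    have h10 := hkF' (entryL 1 0)
    simp only [entryL_apply] at h01 h10
    simp only [hkF' halfDiffL, entryL_apply, h01, h10] at hess
    simp_rw [hess]
    exact forall_re_eq_zero_iff_exists_eq_smul_one (fun w => compress W₀ (fderiv ℝ F y w)) v

end HermMat

end MatrixAnalysis

/-! ### Families in charts -/

section Charts

variable {X : Type*} [TopologicalSpace X] [ChartedSpace (EuclideanSpace ℝ (Fin 3)) X]
  {N : ℕ}

/-- A smooth family read in a chart. -/
def HermFamily.inChart (H : HermFamily X N)
    (e : OpenPartialHomeomorph X (EuclideanSpace ℝ (Fin 3))) :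
    EuclideanSpace ℝ (Fin 3) → HermMat N :=
  fun y => H (e.symm y)

/-- The first jet of `H` at `x` is transverse to the degenerate matrices. -/
def HermFamily.IsGoodAt (H : HermFamily X N)
    (e : OpenPartialHomeomorph X (EuclideanSpace ℝ (Fin 3))) (y : EuclideanSpace ℝ (Fin 3)) :
    Prop :=
  (H.inChart e y).AtMostOneDouble ∧ (H.inChart e y).IsTransverse (fderiv ℝ (H.inChart e) y)

theorem HermFamily.contDiffOn_inChart (H : HermFamily X N)
    {e : OpenPartialHomeomorph X (EuclideanSpace ℝ (Fin 3))}
    (he : e ∈ IsManifold.maximalAtlas (𝓡 3) ∞ X) : ContDiffOn ℝ ∞ (H.inChart e) e.target := by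
  rw [← contMDiffOn_iff_contDiffOn]
  exact H.contMDiff.comp_contMDiffOn (contMDiffOn_symm_of_mem_maximalAtlas he)

theorem HermFamily.contDiffAt_inChart (H : HermFamily X N)
    {e : OpenPartialHomeomorph X (EuclideanSpace ℝ (Fin 3))}
    (he : e ∈ IsManifold.maximalAtlas (𝓡 3) ∞ X) {y : EuclideanSpace ℝ (Fin 3)}
    (hy : y ∈ e.target) : ContDiffAt ℝ ∞ (H.inChart e) y :=
  (H.contDiffOn_inChart he).contDiffAt (e.open_target.mem_nhds hy)

theorem differentiableAt_chart_transition
    {e e' : OpenPartialHomeomorph X (EuclideanSpace ℝ (Fin 3))}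
    (he : e ∈ IsManifold.maximalAtlas (𝓡 3) ∞ X) (he' : e' ∈ IsManifold.maximalAtlas (𝓡 3) ∞ X)
    {x : X} (hx : x ∈ e.source) (hx' : x ∈ e'.source) :
    DifferentiableAt ℝ (fun y => e (e'.symm y)) (e' x) := by
  have h1 : ContMDiffAt (𝓡 3) (𝓡 3) ∞ e (e'.symm (e' x)) := by
    rw [e'.left_inv hx']
    exact contMDiffAt_of_mem_maximalAtlas he hx
  have h2 : ContMDiffAt (𝓡 3) (𝓡 3) ∞ (fun y => e (e'.symm y)) (e' x) :=
    h1.comp (e' x) (contMDiffAt_symm_of_mem_maximalAtlas he' (e'.map_source hx'))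
  exact (contMDiffAt_iff_contDiffAt.mp h2).differentiableAt (by simp)

theorem injective_fderiv_chart_transition
    {e e' : OpenPartialHomeomorph X (EuclideanSpace ℝ (Fin 3))}
    (he : e ∈ IsManifold.maximalAtlas (𝓡 3) ∞ X) (he' : e' ∈ IsManifold.maximalAtlas (𝓡 3) ∞ X)
    {x : X} (hx : x ∈ e.source) (hx' : x ∈ e'.source) :
    Function.Injective (fderiv ℝ (fun y => e (e'.symm y)) (e' x)) := by
  have h1 := (differentiableAt_chart_transition he he' hx hx').hasFDerivAt
  have h2 := (differentiableAt_chart_transition he' he hx' hx).hasFDerivAt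
  have h2' : HasFDerivAt (fun y => e' (e.symm y)) (fderiv ℝ (fun y => e' (e.symm y)) (e x))
      (e (e'.symm (e' x))) := by
    rwa [e'.left_inv hx']
  have h3 := h2'.comp (e' x) h1
  have h4 : HasFDerivAt ((fun y => e' (e.symm y)) ∘ fun y => e (e'.symm y))
      (ContinuousLinearMap.id ℝ (EuclideanSpace ℝ (Fin 3))) (e' x) := by
    refine (hasFDerivAt_id (𝕜 := ℝ) (e' x)).congr_of_eventuallyEq ?_
    have hs : e'.symm ⁻¹' e.source ∈ 𝓝 (e' x) :=
      (e'.continuousAt_symm (e'.map_source hx')).preimage_mem_nhds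
        (by rw [e'.left_inv hx']; exact e.open_source.mem_nhds hx)
    filter_upwards [hs, e'.open_target.mem_nhds (e'.map_source hx')] with y hy hy'
    simp only [Function.comp_apply, id]
    rw [e.left_inv hy, e'.right_inv hy']
  intro v w hvw
  have h5 := h3.unique h4
  have hv := congrArg (fun f => f v) h5
  have hw := congrArg (fun f => f w) h5
  simp only [ContinuousLinearMap.comp_apply, ContinuousLinearMap.id_apply] at hv hw
  rw [← hv, ← hw, hvw]

/-- A change of chart keeps the value and composes the derivative with an injective linear map,
which preserves transversality. -/
theorem HermFamily.IsGoodAt.change_chart {H : HermFamily X N}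
    {e e' : OpenPartialHomeomorph X (EuclideanSpace ℝ (Fin 3))}
    (he : e ∈ IsManifold.maximalAtlas (𝓡 3) ∞ X) (he' : e' ∈ IsManifold.maximalAtlas (𝓡 3) ∞ X)
    {x : X} (hx : x ∈ e.source) (hx' : x ∈ e'.source) (h : H.IsGoodAt e (e x)) :
    H.IsGoodAt e' (e' x) := by
  have hval : H.inChart e' (e' x) = H.inChart e (e x) := by
    simp [HermFamily.inChart, e.left_inv hx, e'.left_inv hx']
  have hd := (differentiableAt_chart_transition he he' hx hx').hasFDerivAt
  have hF : HasFDerivAt (H.inChart e) (fderiv ℝ (H.inChart e) (e x)) (e (e'.symm (e' x))) := by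
    rw [e'.left_inv hx']
    exact ((H.contDiffAt_inChart he (e.map_source hx)).differentiableAt (by simp)).hasFDerivAt
  have hF' : HasFDerivAt (H.inChart e') ((fderiv ℝ (H.inChart e) (e x)).comp
      (fderiv ℝ (fun y => e (e'.symm y)) (e' x))) (e' x) := by
    refine (hF.comp (e' x) hd).congr_of_eventuallyEq ?_
    have hs : e'.symm ⁻¹' e.source ∈ 𝓝 (e' x) :=
      (e'.continuousAt_symm (e'.map_source hx')).preimage_mem_nhds
        (by rw [e'.left_inv hx']; exact e.open_source.mem_nhds hx)
    filter_upwards [hs] with y hy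
    simp only [Function.comp_apply, HermFamily.inChart]
    rw [e.left_inv hy]
  refine ⟨hval ▸ h.1, ?_⟩
  rw [hF'.fderiv, hval]
  exact h.2.comp (injective_fderiv_chart_transition he he' hx hx')

end Charts

/-! ### Conical degeneracies are the transverse ones -/

section Conical

variable {X : Type*} [TopologicalSpace X] [ChartedSpace (EuclideanSpace ℝ (Fin 3)) X]
  {N : ℕ} {H : HermFamily X N} {x₀ : X}

theorem HermFamily.inChart_chartAt (H : HermFamily X N) (x : X) :
    H.inChart (chartAt (EuclideanSpace ℝ (Fin 3)) x)
      (chartAt (EuclideanSpace ℝ (Fin 3)) x x) = H x := by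
  simp [HermFamily.inChart]

theorem HermFamily.isGoodAt_of_not_hasDegeneracyAt (h : ¬ H.HasDegeneracyAt x₀) :
    H.IsGoodAt (chartAt (EuclideanSpace ℝ (Fin 3)) x₀)
      (chartAt (EuclideanSpace ℝ (Fin 3)) x₀ x₀) := by
  have hne : ∀ i j : Fin N, i < j → (H x₀).eig i ≠ (H x₀).eig j :=
    fun i j hij he => h ⟨i, j, hij.ne, he⟩
  rw [HermFamily.IsGoodAt, H.inChart_chartAt]
  refine ⟨fun i j k l hij _ he _ => absurd he (hne i j hij), fun W μ v hW _ => ?_⟩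
  obtain ⟨i, j, hij, hi, hj⟩ := hW.exists_eig_eq
  exact absurd (hi.trans hj.symm) (hne i j hij)

variable [IsManifold (𝓡 3) ∞ X]

theorem HermFamily.isGoodAt_of_hasConicalDegeneracyAt (h : H.HasConicalDegeneracyAt x₀) :
    H.IsGoodAt (chartAt (EuclideanSpace ℝ (Fin 3)) x₀)
      (chartAt (EuclideanSpace ℝ (Fin 3)) x₀ x₀) := by
  obtain ⟨n, m, hm, hnm, hsimple, Ω, ℓ', q', hΩ, hx₀, -, -, hq0, ⟨-, -, hnd⟩, heig⟩ := h
  have hlt : n < m := by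
    rw [Fin.lt_def]
    omega
  have hpair : ∀ i j : Fin N, i < j → (H x₀).eig i = (H x₀).eig j → i = n ∧ j = m := by
    intro i j hij he
    have hi : i = n ∨ i = m := by
      by_contra hcon
      push Not at hcon
      exact hsimple i hcon.1 hcon.2 j hij.ne' he.symm
    have hj : j = n ∨ j = m := by
      by_contra hcon
      push Not at hcon
      exact hsimple j hcon.1 hcon.2 i hij.ne he
    rcases hi with rfl | rfl <;> rcases hj with rfl | rfl
    · exact absurd hij (lt_irrefl _)
    · exact ⟨rfl, rfl⟩
    · exact absurd hij hlt.asymm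
    · exact absurd hij (lt_irrefl _)
  set e := chartAt (EuclideanSpace ℝ (Fin 3)) x₀ with he
  have hsrc : x₀ ∈ e.source := mem_chart_source _ x₀
  have hsm := H.contDiffAt_inChart (IsManifold.chart_mem_maximalAtlas x₀) (e.map_source hsrc)
  have hsm2 : ContDiffAt ℝ 2 (H.inChart e) (e x₀) := contDiffAt_infty.mp hsm 2
  have hval : H.inChart e (e x₀) = H x₀ := H.inChart_chartAt x₀
  refine ⟨fun i j k l hij hkl h1 h2 => ?_, fun W μ v hW hc => ?_⟩
  · rw [hval] at h1 h2
    obtain ⟨rfl, rfl⟩ := hpair i j hij h1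
    obtain ⟨rfl, rfl⟩ := hpair k l hkl h2
    exact ⟨rfl, rfl⟩
  rw [hval] at hW
  obtain ⟨i, j, hij, hi, hj⟩ := hW.exists_eig_eq
  obtain ⟨rfl, rfl⟩ := hpair i j hij (hi.trans hj.symm)
  obtain ⟨ℓ, q, -, -, hev, hess⟩ := hW.exists_local_form (V := EuclideanSpace ℝ (Fin 3))
    (fun k hk1 hk2 hk => hsimple k hk1 hk2 i hk1.symm (hi.trans hk.symm)) hij.ne hi hj
  refine hnd v ?_
  have hc' := (hess (H.inChart e) (e x₀) hsm2 hval v).mpr hc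
  have hcont : ContinuousAt (H.inChart e) (e x₀) := hsm.continuousAt
  -- Both functions are the squared half-gap of the two eigenvalues, so the given `q'` has the
  -- Hessian computed in the local form.
  have heq : (fun y => q' (e.symm y)) =ᶠ[𝓝 (e x₀)] fun y => q (H.inChart e y) := by
    have h1 : ∀ᶠ y in 𝓝 (e x₀), e.symm y ∈ Ω :=
      (e.continuousAt_symm (e.map_source hsrc)).preimage_mem_nhds
        (by rw [e.left_inv hsrc]; exact hΩ.mem_nhds hx₀)
    rw [← hval] at hev
    filter_upwards [h1, hcont.eventually hev] with y hy hy2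
    obtain ⟨e1, e2⟩ := heig _ hy
    change _ = q (H (e.symm y))
    have e3 : q (H (e.symm y)) = (((H (e.symm y)).eig j - (H (e.symm y)).eig i) / 2) ^ 2 := hy2.2
    rw [e3, e1, e2]
    ring_nf
    rw [Real.sq_sqrt (hq0 _ hy)]
  intro w
  rw [(heq.fderiv).fderiv_eq]
  exact hc' w

theorem HermFamily.hasConicalDegeneracyAt_of_isGoodAt (hdeg : H.HasDegeneracyAt x₀)
    (h : H.IsGoodAt (chartAt (EuclideanSpace ℝ (Fin 3)) x₀)
      (chartAt (EuclideanSpace ℝ (Fin 3)) x₀ x₀)) : H.HasConicalDegeneracyAt x₀ := by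
  set e := chartAt (EuclideanSpace ℝ (Fin 3)) x₀ with he
  have hsrc : x₀ ∈ e.source := mem_chart_source _ x₀
  have hsm := H.contDiffAt_inChart (IsManifold.chart_mem_maximalAtlas x₀) (e.map_source hsrc)
  have hsm2 : ContDiffAt ℝ 2 (H.inChart e) (e x₀) := contDiffAt_infty.mp hsm 2
  have hval : H.inChart e (e x₀) = H x₀ := H.inChart_chartAt x₀
  obtain ⟨h1, h2⟩ := h
  rw [hval] at h1 h2
  obtain ⟨n, m, hlt, hnm⟩ : ∃ n m : Fin N, n < m ∧ (H x₀).eig n = (H x₀).eig m := by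
    obtain ⟨i, j, hij, he⟩ := hdeg
    rcases lt_or_gt_of_ne hij with h | h
    · exact ⟨i, j, h, he⟩
    · exact ⟨j, i, h, he.symm⟩
  have hpair : ∀ i j : Fin N, i < j → (H x₀).eig i = (H x₀).eig j → i = n ∧ j = m :=
    fun i j hij he => h1 i j n m hij hlt he hnm
  -- By monotonicity eigenvalue n + 1 lies between eigenvalues n and m, so it coincides with them;
  -- uniqueness of the coinciding pair forces m = n + 1.
  have hsucc : (m : ℕ) = n + 1 := by
    have hlt' : (n : ℕ) < m := hlt
    let k : Fin N := ⟨n + 1, by have := m.2; omega⟩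
    have hnk : n < k := by
      rw [Fin.lt_def]
      exact Nat.lt_succ_self _
    have hkm : k ≤ m := by
      rw [Fin.le_def]
      exact hlt'
    have hk : (H x₀).eig n = (H x₀).eig k := le_antisymm ((H x₀).eig_monotone hnk.le)
      (((H x₀).eig_monotone hkm).trans hnm.ge)
    rw [← (hpair n k hnk hk).2]
  have hsimple : ∀ j : Fin N, j ≠ n → j ≠ m → ∀ k : Fin N, k ≠ j →
      (H x₀).eig k ≠ (H x₀).eig j := by
    intro j hjn hjm k hkj hk
    rcases lt_or_gt_of_ne hkj with h | h
    · exact hjm (hpair k j h hk).2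
    · exact hjn (hpair j k h hk.symm).1
  obtain ⟨U, hU, -, hA⟩ := (H x₀).exists_unitary
  have hframe : (H x₀).IsEigenframe (U.submatrix id ![n, m]) ((H x₀).eig n) := by
    refine (H x₀).isEigenframe_submatrix hU hA ?_ ?_
    · intro a b hab
      fin_cases a <;> fin_cases b <;> simp_all [hlt.ne, hlt.ne']
    · intro a
      fin_cases a <;> simp [hnm]
  obtain ⟨ℓ, q, hℓ, hq, hev, hess⟩ := hframe.exists_local_form (V := EuclideanSpace ℝ (Fin 3))
    (fun k hk1 hk2 hk => hsimple k hk1 hk2 n hk1.symm hk.symm) hlt.ne rfl hnm.symm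
  obtain ⟨O, hO, hOopen, hOmem⟩ := eventually_nhds_iff.mp
    (((hℓ.eventually (by simp)).and (hq.eventually (by simp))).and hev)
  have hcont : Continuous H := H.contMDiff.continuous
  have hq0 : q (H x₀) = 0 := by
    rw [hev.self_of_nhds.2, hnm]
    simp
  -- `q` is locally a square and vanishes at `H x₀`, hence has a local minimum there.
  have hmin : fderiv ℝ q (H x₀) = 0 := by
    refine IsLocalMin.fderiv_eq_zero ?_
    filter_upwards [hev] with A hA
    rw [hq0, hA.2]
    positivity
  refine ⟨n, m, hsucc, hnm, hsimple, H ⁻¹' O, fun x => ℓ (H x), fun x => q (H x),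
    hOopen.preimage hcont, hOmem, ?_, ?_, ?_, ⟨hq0, ?_, ?_⟩, ?_⟩
  · intro x hx
    exact (((hO _ hx).1.1.of_le le_top).contMDiffAt.comp x
      H.contMDiff.contMDiffAt).contMDiffWithinAt
  · intro x hx
    exact (((hO _ hx).1.2.of_le le_top).contMDiffAt.comp x
      H.contMDiff.contMDiffAt).contMDiffWithinAt
  · intro x hx
    simp only [(hO _ hx).2.2]
    positivity
  · have h3 := mfderiv_comp (I := 𝓡 3) (I' := 𝓘(ℝ, HermMat N)) (I'' := 𝓘(ℝ, ℝ)) x₀ (g := q)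
      (f := H) (hq.differentiableAt (by simp)).mdifferentiableAt
      (H.contMDiff.mdifferentiableAt (by simp))
    rw [mfderiv_eq_fderiv, hmin] at h3
    exact h3.trans (ContinuousLinearMap.zero_comp _)
  · intro v hv
    refine h2 _ _ v hframe ((hess (H.inChart e) (e x₀) hsm2 hval v).mp hv)
  · intro x hx
    have hle := (H x).eig_monotone hlt.le
    obtain ⟨e1, e2⟩ := (hO _ hx).2
    simp only [e1, e2]
    rw [Real.sqrt_sq (by linarith)]
    constructor <;> ring

theorem mem_conicalFamilies_iff : H ∈ conicalFamilies X N ↔ ∀ x,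
    H.IsGoodAt (chartAt (EuclideanSpace ℝ (Fin 3)) x)
      (chartAt (EuclideanSpace ℝ (Fin 3)) x x) := by
  constructor
  · intro h x
    by_cases hx : H.HasDegeneracyAt x
    · exact HermFamily.isGoodAt_of_hasConicalDegeneracyAt (h x hx)
    · exact HermFamily.isGoodAt_of_not_hasDegeneracyAt hx
  · exact fun h x hx => HermFamily.hasConicalDegeneracyAt_of_isGoodAt hx (h x)

end Conical

/-! ### Density and openness in the smooth topology -/

section Topology

variable {X : Type*} [TopologicalSpace X] [ChartedSpace (EuclideanSpace ℝ (Fin 3)) X] {N : ℕ}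

theorem dist_fderiv_le_dist_iteratedFDeriv_one {E F : Type*} [NormedAddCommGroup E]
    [NormedSpace ℝ E] [NormedAddCommGroup F] [NormedSpace ℝ F] (f g : E → F) (y : E) :
    dist (fderiv ℝ f y) (fderiv ℝ g y)
      ≤ dist (iteratedFDeriv ℝ 1 f y) (iteratedFDeriv ℝ 1 g y) := by
  rw [dist_eq_norm, dist_eq_norm]
  refine ContinuousLinearMap.opNorm_le_bound _ (norm_nonneg _) fun v => ?_
  have := (iteratedFDeriv ℝ 1 f y - iteratedFDeriv ℝ 1 g y).le_opNorm fun _ => v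
  simpa using this

theorem dist_iteratedFDeriv_add_const_le {E F : Type*} [NormedAddCommGroup E]
    [NormedSpace ℝ E] [NormedAddCommGroup F] [NormedSpace ℝ F] (f : E → F) (b c : F) (k : ℕ)
    (y : E) : dist (iteratedFDeriv ℝ k (fun z => f z + b) y)
      (iteratedFDeriv ℝ k (fun z => f z + c) y) ≤ dist b c := by
  cases k with
  | zero =>
    rw [iteratedFDeriv_zero_eq_comp, iteratedFDeriv_zero_eq_comp, Function.comp_apply,
      Function.comp_apply, LinearIsometryEquiv.dist_map, dist_add_left]
  | succ k =>
    rw [iteratedFDeriv_succ_eq_comp_right, iteratedFDeriv_succ_eq_comp_right]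
    simp [fderiv_add_const]

theorem HermFamily.continuous_iteratedFDeriv
    {e : OpenPartialHomeomorph X (EuclideanSpace ℝ (Fin 3))}
    (he : e ∈ IsManifold.maximalAtlas (𝓡 3) ∞ X) (k : ℕ) :
    Continuous fun H : HermFamily X N =>
      UniformOnFun.ofFun {K : Set (EuclideanSpace ℝ (Fin 3)) | IsCompact K ∧ K ⊆ e.target}
        (iteratedFDeriv ℝ k (H.inChart e)) :=
  continuous_iInf_dom (i := e) (continuous_iInf_dom (i := he)
    (continuous_iInf_dom (i := k) continuous_induced_dom))

theorem HermFamily.eventually_dist_iteratedFDeriv_lt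
    {e : OpenPartialHomeomorph X (EuclideanSpace ℝ (Fin 3))}
    (he : e ∈ IsManifold.maximalAtlas (𝓡 3) ∞ X) (k : ℕ) {K : Set (EuclideanSpace ℝ (Fin 3))}
    (hK : IsCompact K) (hKe : K ⊆ e.target) (H₀ : HermFamily X N) {ε : ℝ} (hε : 0 < ε) :
    ∀ᶠ H : HermFamily X N in 𝓝 H₀, ∀ y ∈ K,
      dist (iteratedFDeriv ℝ k (H₀.inChart e) y) (iteratedFDeriv ℝ k (H.inChart e) y) < ε :=
  Metric.tendstoUniformlyOn_iff.mp (UniformOnFun.tendsto_iff_tendstoUniformlyOn.mp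
    ((HermFamily.continuous_iteratedFDeriv he k).tendsto H₀) K ⟨hK, hKe⟩) ε hε

/-- The 1-jets of `H₀` over `K` form a compact subset of the open set of good jets, hence have a
uniform margin `δ`. Closeness of derivatives of orders 0 and 1 on `K` is enough. -/
theorem HermFamily.isOpen_forall_isGoodAt
    {e : OpenPartialHomeomorph X (EuclideanSpace ℝ (Fin 3))}
    (he : e ∈ IsManifold.maximalAtlas (𝓡 3) ∞ X) {K : Set (EuclideanSpace ℝ (Fin 3))}
    (hK : IsCompact K) (hKe : K ⊆ e.target) :
    IsOpen {H : HermFamily X N | ∀ y ∈ K, H.IsGoodAt e y} := by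
  rw [isOpen_iff_mem_nhds]
  intro H₀ hH₀
  have hcont : ContinuousOn (fun y => (H₀.inChart e y, fderiv ℝ (H₀.inChart e) y)) K :=
    (((H₀.contDiffOn_inChart he).continuousOn).prodMk
      ((H₀.contDiffOn_inChart he).continuousOn_fderiv_of_isOpen e.open_target
        (by simp))).mono hKe
  obtain ⟨δ, hδ, hsub⟩ := (hK.image_of_continuousOn hcont).exists_thickening_subset_open
    HermMat.isOpen_atMostOneDouble_and_isTransverse
    (by rintro _ ⟨y, hy, rfl⟩; exact hH₀ y hy)
  filter_upwards [HermFamily.eventually_dist_iteratedFDeriv_lt he 0 hK hKe H₀ hδ,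
    HermFamily.eventually_dist_iteratedFDeriv_lt he 1 hK hKe H₀ hδ] with H h0 h1 y hy
  refine hsub (a := (H.inChart e y, fderiv ℝ (H.inChart e) y)) ?_
  refine Metric.mem_thickening_iff.mpr ⟨_, ⟨y, hy, rfl⟩, ?_⟩
  rw [dist_comm, Prod.dist_eq]
  refine max_lt ?_ ((dist_fderiv_le_dist_iteratedFDeriv_one _ _ y).trans_lt (h1 y hy))
  have := h0 y hy
  rwa [iteratedFDeriv_zero_eq_comp, iteratedFDeriv_zero_eq_comp, Function.comp_apply,
    Function.comp_apply, LinearIsometryEquiv.dist_map] at this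

/-- The translate of a smooth family by a constant matrix. -/
def HermFamily.addConst (H : HermFamily X N) (B : HermMat N) : HermFamily X N :=
  H + ContMDiffMap.const B

theorem HermFamily.inChart_addConst (H : HermFamily X N) (B : HermMat N)
    (e : OpenPartialHomeomorph X (EuclideanSpace ℝ (Fin 3))) :
    (H.addConst B).inChart e = fun y => H.inChart e y + B := rfl

theorem HermFamily.continuous_addConst (H : HermFamily X N) : Continuous H.addConst := by
  refine continuous_iInf_rng.mpr fun e => continuous_iInf_rng.mpr fun he =>
    continuous_iInf_rng.mpr fun k => continuous_induced_rng.mpr ?_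
  rw [continuous_iff_continuousAt]
  intro B
  refine UniformOnFun.tendsto_iff_tendstoUniformlyOn.mpr fun K _ =>
    Metric.tendstoUniformlyOn_iff.mpr fun ε hε => ?_
  filter_upwards [Metric.ball_mem_nhds B hε] with B' hB' y _
  refine (dist_iteratedFDeriv_add_const_le (H.inChart e) B B' k y).trans_lt ?_
  rwa [dist_comm]

variable [IsManifold (𝓡 3) ∞ X]

/-- Finitely many chart domains cover `X`, each excludes a null set of `B`, and adding `B` leaves
the derivative unchanged. -/
theorem ae_addConst_mem_conicalFamilies [CompactSpace X] (H : HermFamily X N)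
    (μ : Measure (HermMat N)) [μ.IsAddHaarMeasure] :
    ∀ᵐ B ∂μ, H.addConst B ∈ conicalFamilies X N := by
  obtain ⟨t, ht⟩ := CompactSpace.elim_nhds_subcover
    (fun x : X => (chartAt (EuclideanSpace ℝ (Fin 3)) x).source)
    fun x => (chartAt (EuclideanSpace ℝ (Fin 3)) x).open_source.mem_nhds (mem_chart_source _ x)
  have hae : ∀ᵐ B ∂μ, ∀ x ∈ t, ∀ y ∈ (chartAt (EuclideanSpace ℝ (Fin 3)) x).target,
      (H.addConst B).IsGoodAt (chartAt (EuclideanSpace ℝ (Fin 3)) x) y := by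
    refine (Filter.eventually_all_finset t).mpr fun x _ => ?_
    filter_upwards [HermMat.ae_forall_atMostOneDouble_and_isTransverse
      (U := (chartAt (EuclideanSpace ℝ (Fin 3)) x).target) (F := H.inChart (chartAt _ x))
      (by simp) (fun y hy => (H.contDiffAt_inChart (IsManifold.chart_mem_maximalAtlas x)
        hy).differentiableAt (by simp)) μ] with B hB y hy
    rw [HermFamily.IsGoodAt, HermFamily.inChart_addConst, fderiv_add_const]
    exact hB y hy
  filter_upwards [hae] with B hB
  rw [mem_conicalFamilies_iff]
  intro x'
  have hx' : x' ∈ ⋃ x ∈ t, (chartAt (EuclideanSpace ℝ (Fin 3)) x).source := by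
    rw [ht]
    trivial
  obtain ⟨x, hx, hxs⟩ := Set.mem_iUnion₂.mp hx'
  exact (hB x hx _ (OpenPartialHomeomorph.map_source _ hxs)).change_chart
    (IsManifold.chart_mem_maximalAtlas x) (IsManifold.chart_mem_maximalAtlas x') hxs
    (mem_chart_source _ x')

/-- A set of full Haar measure is dense, so admissible `B` come arbitrarily close to 0, and H + B
depends continuously on B. -/
theorem dense_conicalFamilies [CompactSpace X] : Dense (conicalFamilies X N) := by
  intro H
  have hd : Dense {B : HermMat N | H.addConst B ∈ conicalFamilies X N} :=
    Measure.dense_of_ae (ae_addConst_mem_conicalFamilies H Measure.addHaar)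
  have h0 : H.addConst 0 = H := by
    refine ContMDiffMap.ext fun x => ?_
    exact add_zero (H x)
  rw [← h0]
  exact map_mem_closure H.continuous_addConst (hd 0) fun B hB => hB

/-- Preimages of finitely many closed balls inside chart images cover `X`. By chart independence the
set is then a finite intersection of the open conditions on these compact balls. -/
theorem isOpen_conicalFamilies [CompactSpace X] : IsOpen (conicalFamilies X N) := by
  have hr : ∀ x : X, ∃ r > 0, Metric.closedBall (chartAt (EuclideanSpace ℝ (Fin 3)) x x) r
      ⊆ (chartAt (EuclideanSpace ℝ (Fin 3)) x).target := fun x =>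
    Metric.nhds_basis_closedBall.mem_iff.mp
      ((chartAt (EuclideanSpace ℝ (Fin 3)) x).open_target.mem_nhds (mem_chart_target _ x))
  choose r hr0 hr using hr
  obtain ⟨t, ht⟩ := CompactSpace.elim_nhds_subcover
    (fun x : X => (chartAt (EuclideanSpace ℝ (Fin 3)) x).source ∩
      chartAt (EuclideanSpace ℝ (Fin 3)) x ⁻¹'
        Metric.closedBall (chartAt (EuclideanSpace ℝ (Fin 3)) x x) (r x))
    fun x => Filter.inter_mem
      ((chartAt (EuclideanSpace ℝ (Fin 3)) x).open_source.mem_nhds (mem_chart_source _ x))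
      (((chartAt (EuclideanSpace ℝ (Fin 3)) x).continuousAt (mem_chart_source _ x))
        (Metric.closedBall_mem_nhds _ (hr0 x)))
  have heq : conicalFamilies X N = ⋂ x ∈ t, {H : HermFamily X N |
      ∀ y ∈ Metric.closedBall (chartAt (EuclideanSpace ℝ (Fin 3)) x x) (r x),
        H.IsGoodAt (chartAt (EuclideanSpace ℝ (Fin 3)) x) y} := by
    ext H
    rw [mem_conicalFamilies_iff, Set.mem_iInter₂]
    constructor
    · intro h x _ y hy
      set e := chartAt (EuclideanSpace ℝ (Fin 3)) x
      have hye := hr x hy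
      have := (h (e.symm y)).change_chart (IsManifold.chart_mem_maximalAtlas _)
        (IsManifold.chart_mem_maximalAtlas x) (mem_chart_source _ _) (e.map_target hye)
      rwa [e.right_inv hye] at this
    · intro h x'
      have hx' : x' ∈ ⋃ x ∈ t, ((chartAt (EuclideanSpace ℝ (Fin 3)) x).source ∩
          chartAt (EuclideanSpace ℝ (Fin 3)) x ⁻¹'
            Metric.closedBall (chartAt (EuclideanSpace ℝ (Fin 3)) x x) (r x)) := by
        rw [ht]
        trivial
      obtain ⟨x, hx, hxs, hxb⟩ := Set.mem_iUnion₂.mp hx'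
      exact (h x hx _ hxb).change_chart (IsManifold.chart_mem_maximalAtlas x)
        (IsManifold.chart_mem_maximalAtlas x') hxs (mem_chart_source _ x')
  rw [heq]
  exact isOpen_biInter_finset fun x _ => HermFamily.isOpen_forall_isGoodAt
    (IsManifold.chart_mem_maximalAtlas x) (isCompact_closedBall _ _) (hr x)

end Topology

end

theorem mainTheorem1 (X : Type*) [TopologicalSpace X] [T2Space X] [CompactSpace X]
    [ChartedSpace (EuclideanSpace ℝ (Fin 3)) X] [IsManifold (𝓡 3) ∞ X] (N : ℕ) :
    Dense (conicalFamilies X N) ∧ IsOpen (conicalFamilies X N) :=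
  ⟨dense_conicalFamilies, isOpen_conicalFamilies⟩
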